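/- Let $g\ge 0$ be an integer. For characteristics $\alpha,\beta\in\{0,\tfrac12\}^g$ and $X\in\mathbb H_g$ (the Siegel upper half space of symmetric complex $g\times g$ matrices with positive definite imaginary part) let $$\theta\left[{\alpha\atop\beta}\right](0|X)=\sum_{m\in\mathbb Z^g}\exp\{\pi i (m+\alpha)^tX(m+\alpha)+2\pi i(m+\alpha)^t\beta\}$$ be the theta-constant; the characteristic is even if $4\alpha^t\beta$ is even. For $\mathbb B\in\mathbb H_g$ let $\mathcal S(\mathbb B)$ be the set of even characteristics in $\{0,\tfrac12\}^{2g}$ whose theta-constant does not vanish at $\mathbb B$, let $N=\#\mathcal S(\mathbb B)$, and put $\mathcal F(X)=\prod_{[\alpha,\beta]\in\mathcal S(\mathbb B)}\theta\left[{\alpha\atop\beta}\right](0|X)$ for $X$ near $\mathbb B$ (with $\mathcal S(\mathbb B)$ held fixed). Define the matrix $$\Lambda_{ij}=\Lambda(\mathbb B)_{ij}=-\frac{\pi i}{N}\,\frac{\partial\log\mathcal F}{\partial\mathbb B_{ij}}=-\frac{\pi i}{N}\,\frac{1}{\mathcal F(\mathbb B)}\,\frac{d}{dt}\Big|_{t=0}\mathcal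 F\Big(\mathbb B+t\,\frac{E_{ij}+E_{ji}}2\Big),$$ where $E_{ij}$ are the matrix units, so that $d\log\mathcal F=\sum_{i,j}\frac{\partial\log\mathcal F}{\partial\mathbb B_{ij}}\,d\mathbb B_{ij}$ over all ordered pairs $(i,j)$. Let $a_1,\dots,a_g,b_1,\dots,b_g\in\mathbb C^g$ be vectors (the periods of a basis $v_1,\dots,v_g$ of holomorphic differentials along a canonical basis of cycles of a Riemann surface of genus $g$, for instance), and let $\omega_1,\omega_2$ be the matrices $2(\omega_1)_{ij}=(a_j)_i$, $2(\omega_2)_{ij}=(b_j)_i$. Assume that $\omega_1$ is invertible and that $\mathbb B=\omega_1^{-1}\omega_2\in\mathbb H_g$. Let $\gamma=\begin{pmatrix}A&B\\C&D\end{pmatrix}\in Sp(2g,\mathbb Z)$, and let $$b^\gamma_i=\sum_j(A_{ij}b_j+B_{ij}a_j),\qquad a^\gamma_i=\sum_j(C_{ij}b_j+D_{ij}a_j),$$ with matrices $\omega_1^\gamma,\omega_2^\gamma$ formed in the same way from the $a_i^\gamma$ and the $b_i^\gamma$. Then $\omega_1^\gamma$ and $C\mathbb B+D$ are invertible, and $$\mathbb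 B^\gamma:=(\omega_1^\gamma)^{-1}\omega_2^\gamma=(A\mathbb B+B)(C\mathbb B+D)^{-1}\in\mathbb H_g .$$ The matrices $\Lambda=\Lambda(\mathbb B)$ and $\Lambda^\gamma=\Lambda(\mathbb B^\gamma)$ are well defined (for both, $N>0$ and the derivatives exist) and symmetric, and $$\Lambda^\gamma=(C\mathbb B+D)\,\Lambda\,(C\mathbb B+D)^t-\frac{\pi i}{2}\,C\,(C\mathbb B+D)^t .$$ -/

import Mathlib

/-- The Siegel upper half space: symmetric complex `g × g` matrices with positive definite
imaginary part. -/
def siegelUpperHalfSpace (g : ℕ) : Set (Matrix (Fin g) (Fin g) ℂ) :=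
  {𝔹 | 𝔹.IsSymm ∧ (𝔹.map Complex.im).PosDef}

/-- The theta-function with characteristics `[α, β]` and matrix of periods `𝔹`:
`∑ₘ exp (π i (m + α)ᵗ 𝔹 (m + α) + 2 π i (m + α)ᵗ (z + β))`, over `m ∈ ℤ^g`. -/
noncomputable def thetaChar {g : ℕ} (α β z : Fin g → ℂ) (𝔹 : Matrix (Fin g) (Fin g) ℂ) : ℂ :=
  ∑' m : Fin g → ℤ,
    Complex.exp (Real.pi * Complex.I *
        dotProduct (fun i => (m i : ℂ) + α i) (𝔹.mulVec fun i => (m i : ℂ) + α i)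
      + 2 * Real.pi * Complex.I * dotProduct (fun i => (m i : ℂ) + α i) (z + β))

/-- Half-integer characteristics, coded by pairs of bit vectors: the bit vectors `(p, q)` stand
for `α = p / 2`, `β = q / 2`. -/
abbrev HalfChar (g : ℕ) : Type := (Fin g → Fin 2) × (Fin g → Fin 2)

/-- The vector `p / 2` in `{0, 1/2}^g`. -/
noncomputable def halfVec {g : ℕ} (p : Fin g → Fin 2) : Fin g → ℂ :=
  fun i => ((p i : ℕ) : ℂ) / 2

/-- The characteristic `[p/2, q/2]` is even: `4 αᵗ β = pᵗ q` is even. -/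
def HalfChar.IsEven {g : ℕ} (c : HalfChar g) : Prop :=
  Even (∑ i, (c.1 i : ℕ) * (c.2 i : ℕ))

/-- The theta-constant `θ[p/2, q/2](0 | 𝔹)`. -/
noncomputable def thetaConst {g : ℕ} (c : HalfChar g) (𝔹 : Matrix (Fin g) (Fin g) ℂ) : ℂ :=
  thetaChar (halfVec c.1) (halfVec c.2) 0 𝔹

open Classical in
/-- The set `S` of even characteristics whose theta-constant does not vanish at `𝔹`. -/
noncomputable def nonvanishingEven {g : ℕ} (𝔹 : Matrix (Fin g) (Fin g) ℂ) :
    Finset (HalfChar g) :=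
  Finset.univ.filter fun c => c.IsEven ∧ thetaConst c 𝔹 ≠ 0

/-- The product of the theta-constants in a given set `S` of characteristics, as a function of the
matrix of periods. For `S = nonvanishingEven 𝔹` and near `𝔹` this is the function `ℱ`: the set `S`
stays fixed when the matrix of periods varies. -/
noncomputable def thetaProd {g : ℕ} (S : Finset (HalfChar g))
    (X : Matrix (Fin g) (Fin g) ℂ) : ℂ :=
  ∏ c ∈ S, thetaConst c X

/-- The direction `(E_{ij} + E_{ji}) / 2` in the space of symmetric matrices. The derivative in this
direction is `∂/∂𝔹_{ij}` in the usual sense for functions of symmetric matrices (that of the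
heat equation `∂θ/∂𝔹_{ij} = (1 / 4 π i) ∂²θ/∂z_i∂z_j`), so that the differential of `f` is
`∑_{i,j} (∂f/∂𝔹_{ij}) d𝔹_{ij}`, the sum being over all ordered pairs `(i, j)`. -/
noncomputable def symDir {g : ℕ} (i j : Fin g) : Matrix (Fin g) (Fin g) ℂ :=
  (1 / 2 : ℂ) • (Matrix.single i j 1 + Matrix.single j i 1)

/-- The restriction `t ↦ ℱ(𝔹 + t (E_{ij} + E_{ji}) / 2)` of the product `ℱ` of the even
theta-constants which do not vanish at `𝔹`. -/
noncomputable def thetaProdLine {g : ℕ} (𝔹 : Matrix (Fin g) (Fin g) ℂ) (i j : Fin g) : ℂ → ℂ :=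
  fun t => thetaProd (nonvanishingEven 𝔹) (𝔹 + t • symDir i j)

/-- The matrix `Λ_{ij} = -(π i / N) ∂ log ℱ / ∂𝔹_{ij}`, where `N` is the number of factors
of `ℱ`. The derivative of `log ℱ` is `(∂ℱ/∂𝔹_{ij}) / ℱ`, independently of the branch. -/
noncomputable def lambdaMatrix {g : ℕ} (𝔹 : Matrix (Fin g) (Fin g) ℂ) :
    Matrix (Fin g) (Fin g) ℂ :=
  Matrix.of fun i j =>
    -(Real.pi * Complex.I / ((nonvanishingEven 𝔹).card : ℂ)) * logDeriv (thetaProdLine 𝔹 i j) 0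

/-- The matrix `ω` with `2 ω_{ij} = ∮_{c_j} v_i`, where cycles `c_1, …, c_g` are given by their
vectors of periods `c_j = (∮_{c_j} v_1, …, ∮_{c_j} v_g)`. -/
noncomputable def halfPeriodMatrix {g : ℕ} (c : Fin g → Fin g → ℂ) :
    Matrix (Fin g) (Fin g) ℂ :=
  Matrix.of fun i j => c j i / 2

/-- The matrix of `b`-periods `𝔹 = ω₁⁻¹ ω₂` of a system of cycles `a_i, b_i`, given by their
vectors of periods. -/
noncomputable def riemannMatrix {g : ℕ} (a b : Fin g → Fin g → ℂ) : Matrix (Fin g) (Fin g) ℂ :=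
  (halfPeriodMatrix a)⁻¹ * halfPeriodMatrix b

/-- The cycles `M b + K a`, that is `∑_j (M_{ij} b_j + K_{ij} a_j)` for `i = 1, …, g`. -/
def combineCycles {g : ℕ} (M K : Matrix (Fin g) (Fin g) ℤ) (b a : Fin g → Fin g → ℂ) :
    Fin g → Fin g → ℂ :=
  fun i => ∑ j, (M i j • b j + K i j • a j)

/-! Write `M = C𝔹 + D` and `Y = (A𝔹 + B) M⁻¹`. The heart is the modular transformation law of
theta-functions: `exp(-πi zᵗ M⁻¹C z) θ[c](M⁻ᵗ z | Y) = κ θ[c'](z | 𝔹)`, where `c ↦ c'` is an affine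
permutation of the half-integer characteristics and `κ ≠ 0` does not depend on `z`. The value of `κ`
is never needed.

The law follows from uniqueness, without generators of the symplectic group. The left-hand side is
holomorphic and has the quasi-periodicity of `θ[c'](· | 𝔹)`. Such a function becomes periodic after
removal of a character, and its Fourier coefficients are all determined by the one of index 0
(`IsThetaLike.exists_eq_mul`). The multipliers come from `SymplecticRelations.transformed_theta_add`
and are matched modulo 2 by `charMap_fst_parity` and `charMap_snd_parity`.

At `z = 0` the law relates the theta-constants. Its second derivatives at `0` relate the Hessians,
where the quadratic exponential adds a multiple of `C Mᵗ`. By the heat equation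
(`hasDerivAt_thetaConst`) the Hessians are the derivatives in the period matrix. Division by the
theta-constant cancels `κ`, so each nonvanishing characteristic contributes its transformed
logarithmic derivative and the same correction `C Mᵗ / 2`. Averaging over the `N` characteristics
and multiplying by `-πi` gives the theorem. That `N > 0` follows from the addition formula. -/

open MeasureTheory

-- Fourier analysis of periodic holomorphic functions

noncomputable local instance : MeasureSpace UnitAddCircle := ⟨AddCircle.haarAddCircle⟩

local instance : Measure.IsAddHaarMeasure (volume : Measure UnitAddCircle) :=
  inferInstanceAs (Measure.IsAddHaarMeasure AddCircle.haarAddCircle)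

local instance : IsProbabilityMeasure (volume : Measure UnitAddCircle) :=
  inferInstanceAs (IsProbabilityMeasure AddCircle.haarAddCircle)

/-- A parametric integral over a compact space of functions which are entire in the parameter is
entire. -/
theorem differentiable_integral_of_compactSpace {T : Type*} [TopologicalSpace T] [CompactSpace T]
    [MeasurableSpace T] [OpensMeasurableSpace T] (μ : Measure T) [IsFiniteMeasure μ]
    {f : T → ℂ → ℂ} (hf : Continuous (Function.uncurry f)) (hd : ∀ t, Differentiable ℂ (f t)) :
    Differentiable ℂ fun τ => ∫ t, f t τ ∂μ := by
  intro τ₀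
  have hcont : ∀ τ, Continuous fun t => f t τ := fun τ =>
    hf.comp (continuous_id.prodMk continuous_const)
  -- Radius 2 leaves room for a unit circle about each point of the ball of radius 1, so that
  -- Cauchy's estimate bounds the derivatives there by the bound `C` of `f`.
  have hK : IsCompact ((Set.univ : Set T) ×ˢ Metric.closedBall τ₀ 2) :=
    isCompact_univ.prod (isCompact_closedBall _ _)
  obtain ⟨C, hC⟩ := hK.exists_bound_of_continuousOn hf.continuousOn
  have hbound : ∀ t, ∀ τ ∈ Metric.ball τ₀ 1, ‖deriv (f t) τ‖ ≤ C := by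
    intro t τ hτ
    have := Complex.norm_deriv_le_of_forall_mem_sphere_norm_le (f := f t) (c := τ) (R := 1) (C := C)
      one_pos (hd t).diffContOnCl (fun z hz => hC (t, z) ⟨Set.mem_univ _, ?_⟩)
    · simpa using this
    · have h1 : dist z τ = 1 := hz
      have h2 : dist τ τ₀ < 1 := hτ
      have := dist_triangle z τ τ₀
      simp only [Metric.mem_closedBall]
      linarith
  have hint : ∀ τ, Integrable (fun t => f t τ) μ := by
    intro τ
    obtain ⟨C', hC'⟩ := isCompact_univ.exists_bound_of_continuousOn (hcont τ).continuousOn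
    exact Integrable.of_bound (hcont τ).measurable.aestronglyMeasurable C'
      (Filter.Eventually.of_forall fun t => hC' t (Set.mem_univ _))
  have hmeas : Measurable fun t => deriv (f t) τ₀ :=
    (measurable_deriv_with_param hf).comp (measurable_id.prodMk measurable_const)
  exact (hasDerivAt_integral_of_dominated_loc_of_deriv_le (μ := μ) (F := fun τ t => f t τ)
    (F' := fun τ t => deriv (f t) τ) (bound := fun _ => C) (Metric.ball_mem_nhds τ₀ one_pos)
    (Filter.Eventually.of_forall fun τ => (hint τ).aestronglyMeasurable) (hint τ₀)
    hmeas.aestronglyMeasurable (Filter.Eventually.of_forall hbound) (integrable_const C)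
    (Filter.Eventually.of_forall fun t τ _ => (hd t τ).hasDerivAt)).2.differentiableAt

/-- An entire function which is constant on the real axis is constant. -/
theorem Differentiable.eq_of_const_on_real {f : ℂ → ℂ} (hf : Differentiable ℂ f)
    (h : ∀ t : ℝ, f t = f 0) (z : ℂ) : f z = f 0 := by
  have h1 : AnalyticOnNhd ℂ f Set.univ := fun z _ => hf.analyticAt z
  refine h1.eqOn_of_preconnected_of_frequently_eq (g := fun _ => f 0) (z₀ := 0)
    analyticOnNhd_const isPreconnected_univ (Set.mem_univ _) ?_ (Set.mem_univ z)
  have h2 : Filter.Tendsto (fun t : ℝ => (t : ℂ)) (nhdsWithin 0 {0}ᶜ) (nhdsWithin 0 {0}ᶜ) := by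
    refine tendsto_nhdsWithin_of_tendsto_nhds_of_eventually_within _ ?_ ?_
    · exact (Complex.continuous_ofReal.tendsto' 0 0 (by simp)).mono_left nhdsWithin_le_nhds
    · filter_upwards [self_mem_nhdsWithin] with t ht
      simpa using ht
  exact h2.frequently (Filter.Eventually.of_forall h).frequently

/-- The projection `ℝ^g → (ℝ/ℤ)^g`. -/
def torusMk {g : ℕ} (x : Fin g → ℝ) : UnitAddTorus (Fin g) := fun i => (x i : UnitAddCircle)

/-- A representative in `ℝ^g` of a point of the torus. -/
noncomputable def torusRep {g : ℕ} (ξ : UnitAddTorus (Fin g)) : Fin g → ℝ :=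
  fun i => Quotient.out (ξ i)

theorem torusMk_torusRep {g : ℕ} (ξ : UnitAddTorus (Fin g)) : torusMk (torusRep ξ) = ξ :=
  funext fun i => Quotient.out_eq' (ξ i)

theorem isOpenQuotientMap_torusMk (g : ℕ) : IsOpenQuotientMap (torusMk (g := g)) :=
  IsOpenQuotientMap.piMap fun _ => QuotientAddGroup.isOpenQuotientMap_mk

theorem torusMk_add {g : ℕ} (x y : Fin g → ℝ) : torusMk (x + y) = torusMk x + torusMk y := rfl

/-- Coordinatewise coercion of integer vectors. -/
def intVec {g : ℕ} (m : Fin g → ℤ) : Fin g → ℂ := fun i => (m i : ℂ)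

/-- Coordinatewise coercion of real vectors. -/
def realVec {g : ℕ} (x : Fin g → ℝ) : Fin g → ℂ := fun i => (x i : ℂ)

@[simp] theorem intVec_apply {g : ℕ} (m : Fin g → ℤ) (i : Fin g) : intVec m i = (m i : ℂ) := rfl

@[simp] theorem realVec_apply {g : ℕ} (x : Fin g → ℝ) (i : Fin g) : realVec x i = (x i : ℂ) := rfl

@[simp] theorem intVec_zero {g : ℕ} : intVec (0 : Fin g → ℤ) = 0 := by ext; simp

@[simp] theorem intVec_neg {g : ℕ} (m : Fin g → ℤ) : intVec (-m) = -intVec m := by ext; simp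

@[simp] theorem intVec_add {g : ℕ} (m n : Fin g → ℤ) : intVec (m + n) = intVec m + intVec n := by
  ext; simp

@[simp] theorem realVec_zero {g : ℕ} : realVec (0 : Fin g → ℝ) = 0 := by ext; simp

@[simp] theorem realVec_add {g : ℕ} (x y : Fin g → ℝ) : realVec (x + y) = realVec x + realVec y := by
  ext; simp

@[fun_prop] theorem continuous_realVec {g : ℕ} : Continuous (realVec (g := g)) := by
  unfold realVec
  fun_prop

theorem mFourier_torusMk {g : ℕ} (n : Fin g → ℤ) (x : Fin g → ℝ) :
    UnitAddTorus.mFourier n (torusMk x)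
      = Complex.exp (2 * Real.pi * Complex.I * dotProduct (intVec n) (realVec x)) := by
  simp only [UnitAddTorus.mFourier, ContinuousMap.coe_mk, torusMk, fourier_coe_apply]
  rw [← Complex.exp_sum, dotProduct, Finset.mul_sum]
  congr 1
  refine Finset.sum_congr rfl fun i _ => ?_
  simp
  ring

section Periodic

variable {g : ℕ} {F : (Fin g → ℂ) → ℂ}

/-- The function `x ↦ F (x + w)` on the torus, for a periodic function `F`. -/
noncomputable def torusFun (F : (Fin g → ℂ) → ℂ) (w : Fin g → ℂ) (ξ : UnitAddTorus (Fin g)) : ℂ :=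
  F (realVec (torusRep ξ) + w)

/-- The representative chosen by `torusRep` differs from `x` by an integer vector, which periodicity
absorbs. -/
theorem torusFun_torusMk (hF : ∀ z (n : Fin g → ℤ), F (z + intVec n) = F z) (w : Fin g → ℂ)
    (x : Fin g → ℝ) : torusFun F w (torusMk x) = F (realVec x + w) := by
  have h : ∀ i, ∃ n : ℤ, torusRep (torusMk x) i = x i + n := by
    intro i
    have h1 : ((torusRep (torusMk x) i : ℝ) : UnitAddCircle) = (x i : UnitAddCircle) :=
      congrFun (torusMk_torusRep (torusMk x)) i
    obtain ⟨n, hn⟩ := AddSubgroup.mem_zmultiples_iff.1 (QuotientAddGroup.eq.1 h1.symm)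
    refine ⟨n, ?_⟩
    rw [zsmul_eq_mul, mul_one] at hn
    linarith
  choose n hn using h
  rw [torusFun, ← hF (realVec x + w) n]
  congr 1
  funext i
  simp only [Pi.add_apply, realVec_apply, intVec_apply, hn i]
  push_cast
  ring

/-- The projection from `ℝ^g × ℂ` is a quotient map, and the composite with it is built from `F`
directly. Continuity is joint in the point and the parameter, as holomorphy of a parametric integral
requires. -/
theorem continuous_torusFun (hF : ∀ z (n : Fin g → ℤ), F (z + intVec n) = F z)
    (hc : Continuous F) (w u : Fin g → ℂ) :
    Continuous (Function.uncurry fun (ξ : UnitAddTorus (Fin g)) (τ : ℂ) =>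
      torusFun F (w + τ • u) ξ) := by
  have hq := ((isOpenQuotientMap_torusMk g).prodMap (IsOpenQuotientMap.id (X := ℂ))).isQuotientMap
  rw [hq.continuous_iff]
  have : (Function.uncurry fun (ξ : UnitAddTorus (Fin g)) (τ : ℂ) => torusFun F (w + τ • u) ξ) ∘
      Prod.map torusMk id = fun p : (Fin g → ℝ) × ℂ => F (realVec p.1 + (w + p.2 • u)) := by
    funext p
    simp [Function.uncurry, torusFun_torusMk hF]
  rw [this]
  refine hc.comp ?_
  fun_prop

/-- A real translation of `F` is a translation of the torus, so invariance of Haar measure moves it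
onto the character. -/
theorem mFourierCoeff_torusFun_add_real (hF : ∀ z (n : Fin g → ℤ), F (z + intVec n) = F z)
    (n : Fin g → ℤ) (w : Fin g → ℂ) (u : Fin g → ℝ) :
    UnitAddTorus.mFourierCoeff (torusFun F (w + realVec u)) n
      = Complex.exp (2 * Real.pi * Complex.I * dotProduct (intVec n) (realVec u)) *
        UnitAddTorus.mFourierCoeff (torusFun F w) n := by
  have h1 : ∀ ξ : UnitAddTorus (Fin g),
      torusFun F (w + realVec u) ξ = torusFun F w (ξ + torusMk u) := by
    intro ξ
    rw [← torusMk_torusRep ξ, ← torusMk_add, torusFun_torusMk hF, torusFun_torusMk hF]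
    rw [realVec_add, add_right_comm, add_assoc]
  have h2 : ∀ ξ : UnitAddTorus (Fin g), UnitAddTorus.mFourier (-n) ξ
      = Complex.exp (2 * Real.pi * Complex.I * dotProduct (intVec n) (realVec u)) *
        UnitAddTorus.mFourier (-n) (ξ + torusMk u) := by
    intro ξ
    rw [← torusMk_torusRep ξ, ← torusMk_add, mFourier_torusMk, mFourier_torusMk, ← Complex.exp_add]
    congr 1
    rw [realVec_add, intVec_neg, dotProduct_add, neg_dotProduct, neg_dotProduct]
    ring
  unfold UnitAddTorus.mFourierCoeff
  simp_rw [h1]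
  rw [← integral_const_mul,
    ← integral_add_right_eq_self (fun ξ => Complex.exp (2 * Real.pi * Complex.I *
      dotProduct (intVec n) (realVec u)) * UnitAddTorus.mFourier (-n) ξ • torusFun F w ξ)
      (torusMk u)]
  refine integral_congr_ae (Filter.Eventually.of_forall fun ξ => ?_)
  simp only [smul_eq_mul]
  rw [h2 ξ, mul_assoc]

/-- The Fourier coefficients of the translate of a periodic holomorphic function by a complex
vector. -/
theorem mFourierCoeff_torusFun (hF : ∀ z (n : Fin g → ℤ), F (z + intVec n) = F z)
    (hc : Continuous F) (hd : ∀ w u, Differentiable ℂ fun τ : ℂ => F (w + τ • u))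
    (n : Fin g → ℤ) (w : Fin g → ℂ) :
    UnitAddTorus.mFourierCoeff (torusFun F w) n
      = Complex.exp (2 * Real.pi * Complex.I * dotProduct (intVec n) w) *
        UnitAddTorus.mFourierCoeff (torusFun F 0) n := by
  set x : Fin g → ℝ := fun i => (w i).re
  set y : Fin g → ℝ := fun i => (w i).im
  have hdiff : Differentiable ℂ fun τ : ℂ =>
      UnitAddTorus.mFourierCoeff (torusFun F (0 + τ • realVec y)) n := by
    unfold UnitAddTorus.mFourierCoeff
    refine differentiable_integral_of_compactSpace volume (f := fun ξ τ =>
      UnitAddTorus.mFourier (-n) ξ • torusFun F (0 + τ • realVec y) ξ) ?_ ?_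
    · exact ((UnitAddTorus.mFourier (-n)).continuous.comp continuous_fst).smul
        (continuous_torusFun hF hc 0 (realVec y))
    · intro ξ
      simpa [torusFun] using
        (hd (realVec (torusRep ξ)) (realVec y)).const_mul (UnitAddTorus.mFourier (-n) ξ)
  -- The real case makes this entire function constant on the real axis, hence everywhere. Its value
  -- at `τ = i` handles the imaginary part `y` of `w`, in place of a shift of contours.
  have key := Differentiable.eq_of_const_on_real
    (f := fun τ : ℂ => Complex.exp (-(2 * Real.pi * Complex.I * dotProduct (intVec n) (realVec y)) * τ)
      * UnitAddTorus.mFourierCoeff (torusFun F (0 + τ • realVec y)) n)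
    (((differentiable_id.const_mul _).cexp).mul hdiff) ?_ Complex.I
  · have hw : w = 0 + Complex.I • realVec y + realVec x := by
      funext i
      simp only [Pi.add_apply, Pi.smul_apply, smul_eq_mul, realVec_apply, x, y,
      zero_add]
      rw [add_comm, mul_comm, Complex.re_add_im]
    have hw' : dotProduct (intVec n) w = dotProduct (intVec n) (realVec y) * Complex.I
        + dotProduct (intVec n) (realVec x) := by
      conv_lhs => rw [hw]
      rw [dotProduct_add, dotProduct_add, dotProduct_smul]
      simp [mul_comm]
    conv_lhs => rw [hw, mFourierCoeff_torusFun_add_real hF]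
    simp only [mul_zero, Complex.exp_zero, one_mul, zero_smul, add_zero] at key
    rw [← key, hw', ← mul_assoc, ← Complex.exp_add]
    congr 2
    ring
  · intro t
    have h1 : (0 : Fin g → ℂ) + (t : ℂ) • realVec y = 0 + realVec (t • y) := by
      funext i; simp
    have h2 : dotProduct (intVec n) (realVec (t • y)) = t * dotProduct (intVec n) (realVec y) := by
      rw [← smul_eq_mul, ← dotProduct_smul]
      congr 1
      funext i; simp
    rw [h1, mFourierCoeff_torusFun_add_real hF, h2, ← mul_assoc, ← Complex.exp_add]
    simp only [mul_zero, zero_smul, add_zero, Complex.exp_zero]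
    congr 1
    rw [Complex.exp_eq_one_iff]
    exact ⟨0, by push_cast; ring⟩

/-- The Fourier expansion of a periodic holomorphic function. -/
theorem hasSum_fourier_of_periodic (hF : ∀ z (n : Fin g → ℤ), F (z + intVec n) = F z)
    (hc : Continuous F) (hd : ∀ w u, Differentiable ℂ fun τ : ℂ => F (w + τ • u)) (w : Fin g → ℂ)
    (hs : Summable fun n => UnitAddTorus.mFourierCoeff (torusFun F 0) n *
      Complex.exp (2 * Real.pi * Complex.I * dotProduct (intVec n) w)) :
    HasSum (fun n => UnitAddTorus.mFourierCoeff (torusFun F 0) n *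
      Complex.exp (2 * Real.pi * Complex.I * dotProduct (intVec n) w)) (F w) := by
  have hcont : Continuous (torusFun F w) := by
    have h := (continuous_torusFun hF hc w 0).comp
      (continuous_id.prodMk (continuous_const (y := (0 : ℂ))))
    simpa [Function.comp_def, Function.uncurry] using h
  -- The Fourier series of the translate by `w`, evaluated at the origin of the torus, is the
  -- expansion of `F` at the complex point `w`.
  have h1 := UnitAddTorus.hasSum_mFourier_series_apply_of_summable
    (f := (⟨torusFun F w, hcont⟩ : C(UnitAddTorus (Fin g), ℂ))) (by
      refine hs.congr fun n => ?_
      rw [ContinuousMap.coe_mk, mFourierCoeff_torusFun hF hc hd n w, mul_comm]) (torusMk 0)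
  rw [ContinuousMap.coe_mk, torusFun_torusMk hF, realVec_zero, zero_add] at h1
  refine h1.congr_fun fun n => ?_
  rw [mFourierCoeff_torusFun hF hc hd n w, mFourier_torusMk, realVec_zero]
  simp [mul_comm]

end Periodic

/-- A Fourier series with absolutely summable coefficients which vanishes identically has vanishing
constant coefficient. -/
theorem fourier_coeff_zero_of_forall_tsum_eq_zero {g : ℕ} {c : (Fin g → ℤ) → ℂ}
    (hc : Summable fun n => ‖c n‖)
    (h : ∀ x : Fin g → ℝ, ∑' n, c n *
      Complex.exp (2 * Real.pi * Complex.I * dotProduct (intVec n) (realVec x)) = 0) : c 0 = 0 := by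
  have h1 : Summable fun n => c n • UnitAddTorus.mFourier (d := Fin g) n := by
    refine Summable.of_norm ?_
    simpa [norm_smul, UnitAddTorus.mFourier_norm] using hc
  have h2 : ∑' n, c n • UnitAddTorus.mFourier (d := Fin g) n = 0 := by
    ext ξ
    rw [ContinuousMap.zero_apply, ← h (torusRep ξ)]
    refine (ContinuousMap.tsum_apply h1 ξ).symm.trans (tsum_congr fun n => by
      rw [← mFourier_torusMk, torusMk_torusRep]
      rfl)
  have h3 := h1.hasSum
  rw [h2] at h3
  -- Pairing in `L²` with the constant character isolates `c 0`.
  have h4 := (h3.mapL (ContinuousMap.toLp (E := ℂ) 2 (volume : Measure (UnitAddTorus (Fin g)))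
    ℂ)).mapL (innerSL ℂ (UnitAddTorus.mFourierLp 2 (0 : Fin g → ℤ)))
  simp only [map_smul, map_zero, smul_eq_mul, innerSL_apply_apply] at h4
  have h5 : ∀ n, inner ℂ (UnitAddTorus.mFourierLp 2 (0 : Fin g → ℤ))
      (UnitAddTorus.mFourierLp 2 n) = if 0 = n then (1 : ℂ) else 0 := fun n =>
    orthonormal_iff_ite.1 UnitAddTorus.orthonormal_mFourier 0 n
  simp only [h5] at h4
  have h6 := h4.unique (hasSum_single 0 fun n hn => by simp [hn.symm])
  simpa using h6.symm

/-! ### Convergence and termwise differentiation of theta-series -/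

theorem abs_apply_sum_le_card_mul_norm {g : ℕ} (x : Fin g → ℝ) : ∑ i, |x i| ≤ g * ‖x‖ := by
  calc ∑ i, |x i| ≤ ∑ _i : Fin g, ‖x‖ := Finset.sum_le_sum fun i _ => norm_le_pi_norm x i
    _ = g * ‖x‖ := by simp

theorem norm_dotProduct_le_card {g : ℕ} (x : Fin g → ℝ) (w : Fin g → ℂ) :
    ‖dotProduct (realVec x) w‖ ≤ g * ‖x‖ * ‖w‖ := by
  calc ‖dotProduct (realVec x) w‖ ≤ ∑ _i : Fin g, ‖x‖ * ‖w‖ := by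
        refine norm_sum_le_of_le _ fun i _ => ?_
        rw [norm_mul]
        refine mul_le_mul ?_ (norm_le_pi_norm w i) (norm_nonneg _) (norm_nonneg _)
        simpa using norm_le_pi_norm x i
    _ = g * ‖x‖ * ‖w‖ := by simp [mul_assoc]

/-- A positive definite form is bounded below by a multiple of the square of the norm. -/
theorem Matrix.PosDef.exists_pos_mul_norm_sq_le {g : ℕ} {Y : Matrix (Fin g) (Fin g) ℝ}
    (hY : Y.PosDef) : ∃ c > 0, ∀ x : Fin g → ℝ, c * ‖x‖ ^ 2 ≤ dotProduct x (Y.mulVec x) := by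
  have hpos : ∀ x : Fin g → ℝ, x ≠ 0 → 0 < dotProduct x (Y.mulVec x) := fun x hx => by
    simpa using hY.dotProduct_mulVec_pos hx
  have hcont : Continuous fun x : Fin g → ℝ => dotProduct x (Y.mulVec x) := by
    unfold dotProduct Matrix.mulVec dotProduct
    fun_prop
  have key : ∃ c > 0, ∀ x : Fin g → ℝ, ‖x‖ = 1 → c ≤ dotProduct x (Y.mulVec x) := by
    by_cases hne : (Metric.sphere (0 : Fin g → ℝ) 1).Nonempty
    · obtain ⟨x₀, hx₀, hmin⟩ := (isCompact_sphere (0 : Fin g → ℝ) 1).exists_isMinOn hne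
        hcont.continuousOn
      have : x₀ ≠ 0 := by
        rintro rfl
        simp at hx₀
      exact ⟨_, hpos x₀ this, fun x hx => hmin (by simpa using hx)⟩
    -- An empty sphere occurs for `g = 0`; any constant will do.
    · refine ⟨1, one_pos, fun x hx => (hne ⟨x, by simpa using hx⟩).elim⟩
  obtain ⟨c, hc, h⟩ := key
  refine ⟨c, hc, fun x => ?_⟩
  rcases eq_or_ne x 0 with rfl | hx
  · simp
  have hn : 0 < ‖x‖ := norm_pos_iff.2 hx
  have h1 := h (‖x‖⁻¹ • x) (by rw [norm_smul, norm_inv, norm_norm, inv_mul_cancel₀ hn.ne'])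
  rw [Matrix.mulVec_smul, dotProduct_smul, smul_dotProduct, smul_eq_mul, smul_eq_mul,
    ← mul_assoc, ← mul_inv, ← sq, le_inv_mul_iff₀ (by positivity)] at h1
  linarith

theorem summable_prod_apply {f : ℤ → ℝ} (hf : Summable f) (h0 : ∀ n, 0 ≤ f n) (g : ℕ) :
    Summable fun m : Fin g → ℤ => ∏ i, f (m i) := by
  induction g with
  | zero => exact Summable.of_finite
  | succ g ih =>
    rw [← (Fin.consEquiv fun _ => ℤ).summable_iff]
    refine (hf.mul_of_nonneg ih h0 fun m => Finset.prod_nonneg fun i _ => h0 _).congr fun p => ?_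
    simp [Fin.prod_univ_succ, Fin.consEquiv]

theorem summable_exp_neg_abs_int : Summable fun n : ℤ => Real.exp (-|(n : ℝ)|) := by
  refine Summable.of_nat_of_neg ?_ ?_ <;>
  · simpa using Real.summable_exp_neg_nat

/-- The shift of an integer vector by a real vector. -/
def shiftVec {g : ℕ} (a : Fin g → ℝ) (m : Fin g → ℤ) : Fin g → ℝ := fun i => m i + a i

theorem realVec_shiftVec {g : ℕ} (a : Fin g → ℝ) (m : Fin g → ℤ) :
    realVec (shiftVec a m) = intVec m + realVec a := by
  ext; simp [shiftVec]

/-- The comparison series is `∏ exp(-|m i|)`. With `t = ‖shiftVec a m‖` one has `∑ |m i| ≤ g (t +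
‖a‖)`, so it remains to bound `(K + g) t - c t²`, whose maximum is `(K + g)² / (4c)`. -/
theorem summable_exp_gaussian {g : ℕ} (a : Fin g → ℝ) (K : ℝ) {c : ℝ} (hc : 0 < c) :
    Summable fun m : Fin g → ℤ =>
      Real.exp (K * ‖shiftVec a m‖ - c * ‖shiftVec a m‖ ^ 2) := by
  have h := (summable_prod_apply summable_exp_neg_abs_int (fun _ => (Real.exp_pos _).le) g).mul_left
    (Real.exp (g * ‖a‖ + (K + g) ^ 2 / (4 * c)))
  refine h.of_nonneg_of_le (fun _ => (Real.exp_pos _).le) fun m => ?_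
  rw [← Real.exp_sum, ← Real.exp_add, Real.exp_le_exp, Finset.sum_neg_distrib]
  set t := ‖shiftVec a m‖
  have h1 : ∑ i, |(m i : ℝ)| ≤ g * t + g * ‖a‖ := by
    have h2 := abs_apply_sum_le_card_mul_norm fun i => (m i : ℝ)
    have h3 : ‖fun i => (m i : ℝ)‖ ≤ t + ‖a‖ := by
      have : (fun i => (m i : ℝ)) = shiftVec a m - a := by
        ext i; simp [shiftVec]
      rw [this]
      exact norm_sub_le _ _
    nlinarith [Nat.cast_nonneg (α := ℝ) g]
  have h4 : (K + g) * t - c * t ^ 2 ≤ (K + g) ^ 2 / (4 * c) := by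
    rw [le_div_iff₀ (by positivity)]
    nlinarith [sq_nonneg (2 * c * t - (K + g))]
  linarith

/-- The general term of the theta-series. -/
noncomputable def thetaTerm {g : ℕ} (α w : Fin g → ℂ) (X : Matrix (Fin g) (Fin g) ℂ)
    (m : Fin g → ℤ) : ℂ :=
  Complex.exp (Real.pi * Complex.I * dotProduct (intVec m + α) (X.mulVec (intVec m + α))
    + 2 * Real.pi * Complex.I * dotProduct (intVec m + α) w)

theorem thetaChar_eq_tsum {g : ℕ} (α β z : Fin g → ℂ) (X : Matrix (Fin g) (Fin g) ℂ) :
    thetaChar α β z X = ∑' m, thetaTerm α (z + β) X m := rfl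

theorem im_dotProduct_mulVec_realVec {g : ℕ} (X : Matrix (Fin g) (Fin g) ℂ) (x : Fin g → ℝ) :
    (dotProduct (realVec x) (X.mulVec (realVec x))).im
      = dotProduct x ((X.map Complex.im).mulVec x) := by
  simp [dotProduct, Matrix.mulVec, Finset.mul_sum]

/-- The terms of the theta-series decay like a Gaussian. -/
theorem exists_norm_thetaTerm_le {g : ℕ} {X : Matrix (Fin g) (Fin g) ℂ}
    (hX : X ∈ siegelUpperHalfSpace g) : ∃ c > 0, ∀ (a : Fin g → ℝ) (w : Fin g → ℂ) (m : Fin g → ℤ),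
      ‖thetaTerm (realVec a) w X m‖
        ≤ Real.exp (2 * Real.pi * g * ‖w‖ * ‖shiftVec a m‖ - c * ‖shiftVec a m‖ ^ 2) := by
  obtain ⟨c, hc, h⟩ := hX.2.exists_pos_mul_norm_sq_le
  refine ⟨Real.pi * c, by positivity, fun a w m => ?_⟩
  rw [thetaTerm, ← realVec_shiftVec, Complex.norm_exp, Real.exp_le_exp, Complex.add_re]
  set x := shiftVec a m
  have h1 : (Real.pi * Complex.I * dotProduct (realVec x) (X.mulVec (realVec x))).re
      = - (Real.pi * dotProduct x ((X.map Complex.im).mulVec x)) := by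
    rw [← im_dotProduct_mulVec_realVec, mul_assoc, Complex.re_ofReal_mul, Complex.I_mul_re]
    ring
  have h2 : (2 * Real.pi * Complex.I * dotProduct (realVec x) w).re
      ≤ 2 * Real.pi * (g * ‖x‖ * ‖w‖) := by
    refine (Complex.re_le_norm _).trans ?_
    rw [norm_mul]
    refine mul_le_mul (le_of_eq ?_) (norm_dotProduct_le_card x w) (norm_nonneg _) (by positivity)
    simp [abs_of_pos Real.pi_pos]
  have h3 := mul_le_mul_of_nonneg_left (h x) Real.pi_pos.le
  rw [h1]
  linarith

/-- Termwise differentiation of a series of exponentials. -/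
theorem hasDerivAt_tsum_exp {ι : Type*} {P A B : ι → ℂ} {δ : ℝ}
    (hs : Summable fun m => ‖P m * Complex.exp (A m)‖ * Real.exp (δ * ‖B m‖)) {τ : ℂ}
    (hτ : ‖τ‖ < δ) :
    HasDerivAt (fun τ => ∑' m, P m * Complex.exp (A m + τ * B m))
      (∑' m, P m * B m * Complex.exp (A m + τ * B m)) τ := by
  have hd : ∀ m, ∀ τ, HasDerivAt (fun τ => P m * Complex.exp (A m + τ * B m))
      (P m * B m * Complex.exp (A m + τ * B m)) τ := by
    intro m τ
    have := ((((hasDerivAt_id τ).mul_const (B m)).const_add (A m)).cexp).const_mul (P m)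
    exact this.congr_deriv (by simp only [id]; ring)
  have hle : ∀ m, ∀ τ ∈ Metric.ball (0 : ℂ) δ, ‖P m * Complex.exp (A m + τ * B m)‖
      ≤ ‖P m * Complex.exp (A m)‖ * Real.exp (δ * ‖B m‖) := by
    intro m τ hτ
    rw [Complex.exp_add, ← mul_assoc, norm_mul]
    refine mul_le_mul_of_nonneg_left ?_ (norm_nonneg _)
    rw [Complex.norm_exp, Real.exp_le_exp]
    refine (Complex.re_le_norm _).trans ?_
    rw [norm_mul]
    exact mul_le_mul_of_nonneg_right (by simpa using (Metric.mem_ball.1 hτ).le) (norm_nonneg _)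
  have hmem : τ ∈ Metric.ball (0 : ℂ) δ := by simpa using hτ
  have h1 := Complex.differentiableOn_tsum_of_summable_norm hs
    (fun m => fun τ _ => (hd m τ).differentiableAt.differentiableWithinAt) Metric.isOpen_ball hle
  have h2 := Complex.hasSum_deriv_of_summable_norm hs
    (fun m => fun τ _ => (hd m τ).differentiableAt.differentiableWithinAt) Metric.isOpen_ball hle
    hmem
  have h3 := (h1.differentiableAt (Metric.isOpen_ball.mem_nhds hmem)).hasDerivAt
  rw [← h2.tsum_eq] at h3
  simpa only [(hd _ τ).deriv] using h3

section Theta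

variable {g : ℕ} {X : Matrix (Fin g) (Fin g) ℂ}

/-- The theta-series converges absolutely, also with weights of exponential growth. -/
theorem summable_mul_norm_thetaTerm (hX : X ∈ siegelUpperHalfSpace g) (a : Fin g → ℝ)
    (w : Fin g → ℂ) {P : (Fin g → ℤ) → ℝ} {C L : ℝ}
    (hP : ∀ m, |P m| ≤ C * Real.exp (L * ‖shiftVec a m‖)) :
    Summable fun m => P m * ‖thetaTerm (realVec a) w X m‖ := by
  obtain ⟨c, hc, h⟩ := exists_norm_thetaTerm_le hX
  refine Summable.of_norm_bounded
    ((summable_exp_gaussian a (L + 2 * Real.pi * g * ‖w‖) hc).mul_left C) fun m => ?_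
  rw [norm_mul, norm_norm, Real.norm_eq_abs]
  calc |P m| * ‖thetaTerm (realVec a) w X m‖
      ≤ (C * Real.exp (L * ‖shiftVec a m‖)) *
        Real.exp (2 * Real.pi * g * ‖w‖ * ‖shiftVec a m‖ - c * ‖shiftVec a m‖ ^ 2) :=
        mul_le_mul (hP m) (h a w m) (norm_nonneg _) ((abs_nonneg _).trans (hP m))
    _ = _ := by
        rw [mul_assoc, ← Real.exp_add]
        ring_nf

theorem summable_norm_thetaTerm (hX : X ∈ siegelUpperHalfSpace g) (a : Fin g → ℝ)
    (w : Fin g → ℂ) :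
    Summable fun m => ‖thetaTerm (realVec a) w X m‖ := by
  simpa using summable_mul_norm_thetaTerm hX a w (P := fun _ => 1) (C := 1) (L := 0) (by simp)

/-- The rate of decay does not depend on the argument, so one Gaussian majorant serves a whole unit
ball about `z₀`. -/
theorem continuous_thetaChar (hX : X ∈ siegelUpperHalfSpace g) (a : Fin g → ℝ)
    (β : Fin g → ℂ) :
    Continuous fun z => thetaChar (realVec a) β z X := by
  obtain ⟨c, hc, h⟩ := exists_norm_thetaTerm_le hX
  refine continuous_iff_continuousAt.2 fun z₀ => ?_
  have h1 : ContinuousOn (fun z => ∑' m, thetaTerm (realVec a) (z + β) X m)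
      (Metric.ball z₀ 1) := by
    refine continuousOn_tsum (fun m => ?_)
      (summable_exp_gaussian a (2 * Real.pi * g * (‖z₀‖ + 1 + ‖β‖)) hc) fun m z hz => ?_
    · refine Continuous.continuousOn ?_
      unfold thetaTerm dotProduct
      fun_prop
    · refine (h a (z + β) m).trans (Real.exp_le_exp.2 ?_)
      have h2 : ‖z‖ ≤ ‖z₀‖ + 1 := by
        have := norm_le_norm_add_norm_sub' z z₀
        have h3 : ‖z - z₀‖ < 1 := by simpa [dist_eq_norm] using hz
        linarith
      have h4 : ‖z + β‖ ≤ ‖z₀‖ + 1 + ‖β‖ := (norm_add_le _ _).trans (by linarith)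
      gcongr
  exact h1.continuousAt (Metric.ball_mem_nhds z₀ one_pos)

/-- Termwise differentiation of a weighted theta-series along a line. -/
theorem hasDerivAt_thetaSeries_line (hX : X ∈ siegelUpperHalfSpace g) (a : Fin g → ℝ)
    (w u : Fin g → ℂ) {P : (Fin g → ℤ) → ℂ} {C L : ℝ}
    (hP : ∀ m, ‖P m‖ ≤ C * Real.exp (L * ‖shiftVec a m‖)) (τ : ℂ) :
    HasDerivAt (fun τ : ℂ => ∑' m, P m * thetaTerm (realVec a) (w + τ • u) X m)
      (∑' m, P m * (2 * Real.pi * Complex.I * dotProduct (intVec m + realVec a) u) *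
        thetaTerm (realVec a) (w + τ • u) X m) τ := by
  have hB : ∀ m, ‖2 * Real.pi * Complex.I * dotProduct (intVec m + realVec a) u‖
      ≤ 2 * Real.pi * g * ‖u‖ * ‖shiftVec a m‖ := by
    intro m
    rw [norm_mul, ← realVec_shiftVec]
    have := norm_dotProduct_le_card (shiftVec a m) u
    have h2 : ‖(2 * Real.pi * Complex.I : ℂ)‖ = 2 * Real.pi := by simp [abs_of_pos Real.pi_pos]
    rw [h2]
    nlinarith [Real.pi_pos]
  -- Along the line the exponent changes by a term linear in the shifted index. On the disc of
  -- radius `‖τ‖ + 1` this costs an exponential factor, absorbed by the Gaussian decay.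
  have hs : Summable fun m => ‖P m * Complex.exp (Real.pi * Complex.I *
      dotProduct (intVec m + realVec a) (X.mulVec (intVec m + realVec a))
      + 2 * Real.pi * Complex.I * dotProduct (intVec m + realVec a) w)‖ *
      Real.exp ((‖τ‖ + 1) * ‖2 * Real.pi * Complex.I * dotProduct (intVec m + realVec a) u‖) := by
    refine (summable_mul_norm_thetaTerm hX a w (P := fun m => ‖P m‖ * Real.exp ((‖τ‖ + 1) *
      ‖2 * Real.pi * Complex.I * dotProduct (intVec m + realVec a) u‖)) (C := C)
      (L := L + (‖τ‖ + 1) * (2 * Real.pi * g * ‖u‖)) fun m => ?_).congr fun m => ?_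
    · rw [abs_of_nonneg (by positivity), add_mul L, Real.exp_add, ← mul_assoc]
      refine mul_le_mul (hP m) (Real.exp_le_exp.2 ?_) (Real.exp_pos _).le
        ((norm_nonneg _).trans (hP m))
      rw [mul_assoc (‖τ‖ + 1)]
      exact mul_le_mul_of_nonneg_left (hB m) (by positivity)
    · rw [norm_mul (P m), thetaTerm]
      ring
  have key := hasDerivAt_tsum_exp hs (τ := τ) (by linarith)
  have hterm : ∀ (τ : ℂ) m, thetaTerm (realVec a) (w + τ • u) X m = Complex.exp (Real.pi * Complex.I *
      dotProduct (intVec m + realVec a) (X.mulVec (intVec m + realVec a))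
      + 2 * Real.pi * Complex.I * dotProduct (intVec m + realVec a) w +
      τ * (2 * Real.pi * Complex.I * dotProduct (intVec m + realVec a) u)) := by
    intro τ m
    rw [thetaTerm, dotProduct_add, dotProduct_smul, smul_eq_mul]
    ring_nf
  simpa only [hterm] using key

theorem differentiable_thetaChar_line (hX : X ∈ siegelUpperHalfSpace g) (a : Fin g → ℝ)
    (β w u : Fin g → ℂ) :
    Differentiable ℂ fun τ : ℂ => thetaChar (realVec a) β (w + τ • u) X := by
  intro τ
  have := (hasDerivAt_thetaSeries_line hX a (w + β) u (P := fun _ => 1) (C := 1) (L := 0)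
    (by simp) τ).differentiableAt
  simpa only [one_mul, thetaChar_eq_tsum, add_right_comm] using this

end Theta

/-! ### Quasi-periodicity and uniqueness of theta-functions -/

theorem exp_two_pi_I_mul_intCast (n : ℤ) : Complex.exp (2 * Real.pi * Complex.I * n) = 1 :=
  Complex.exp_eq_one_iff.2 ⟨n, by ring⟩

theorem dotProduct_intVec {g : ℕ} (m n : Fin g → ℤ) :
    dotProduct (intVec m) (intVec n) = ((dotProduct m n : ℤ) : ℂ) := by
  simp [dotProduct]

theorem Matrix.IsSymm.dotProduct_mulVec_comm {n R : Type*} [Fintype n] [CommRing R]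
    {X : Matrix n n R} (hX : X.IsSymm) (u v : n → R) :
    dotProduct u (X.mulVec v) = dotProduct v (X.mulVec u) := by
  rw [Matrix.dotProduct_mulVec, ← Matrix.mulVec_transpose, hX.eq, dotProduct_comm]

/-- Quasi-periodicity of theta-functions with characteristics: the multiplier of the period
`n + X l`. -/
structure IsThetaLike {g : ℕ} (α β : Fin g → ℂ) (X : Matrix (Fin g) (Fin g) ℂ)
    (f : (Fin g → ℂ) → ℂ) : Prop where
  continuous : Continuous f
  differentiable_line : ∀ w u, Differentiable ℂ fun τ : ℂ => f (w + τ • u)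
  add_int : ∀ z (n : Fin g → ℤ),
    f (z + intVec n) = Complex.exp (2 * Real.pi * Complex.I * dotProduct α (intVec n)) * f z
  add_mulVec : ∀ z (l : Fin g → ℤ), f (z + X.mulVec (intVec l)) =
    Complex.exp (-(2 * Real.pi * Complex.I * dotProduct β (intVec l))
      - Real.pi * Complex.I * dotProduct (intVec l) (X.mulVec (intVec l))
      - 2 * Real.pi * Complex.I * dotProduct (intVec l) z) * f z

section

variable {g : ℕ} {X : Matrix (Fin g) (Fin g) ℂ}

theorem thetaChar_add_int (α β z : Fin g → ℂ) (n : Fin g → ℤ) :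
    thetaChar α β (z + intVec n) X
      = Complex.exp (2 * Real.pi * Complex.I * dotProduct α (intVec n)) * thetaChar α β z X := by
  rw [thetaChar_eq_tsum, thetaChar_eq_tsum, ← tsum_mul_left]
  refine tsum_congr fun m => ?_
  rw [← one_mul (thetaTerm α (z + intVec n + β) X m),
    ← exp_two_pi_I_mul_intCast (-(dotProduct m n)), thetaTerm, thetaTerm, ← Complex.exp_add,
    ← Complex.exp_add]
  congr 1
  push_cast
  rw [← dotProduct_intVec, dotProduct_add, dotProduct_add, dotProduct_add, add_dotProduct _ _ (intVec n)]
  ring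

/-- Shifting the summation index by `l` completes the square; symmetry of `X` merges the cross
terms. -/
theorem thetaChar_add_mulVec (hX : X.IsSymm) (α β z : Fin g → ℂ) (l : Fin g → ℤ) :
    thetaChar α β (z + X.mulVec (intVec l)) X =
    Complex.exp (-(2 * Real.pi * Complex.I * dotProduct β (intVec l))
      - Real.pi * Complex.I * dotProduct (intVec l) (X.mulVec (intVec l))
      - 2 * Real.pi * Complex.I * dotProduct (intVec l) z) * thetaChar α β z X := by
  rw [thetaChar_eq_tsum, thetaChar_eq_tsum, 
    ← (Equiv.addRight l).tsum_eq (thetaTerm α (z + β) X), ← tsum_mul_left]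
  refine tsum_congr fun m => ?_
  rw [thetaTerm, thetaTerm, ← Complex.exp_add]
  congr 1
  have h : intVec ((Equiv.addRight l) m) + α = (intVec m + α) + intVec l := by
    simp only [Equiv.coe_addRight, intVec_add]
    abel
  rw [h]
  generalize intVec m + α = v
  simp only [Matrix.mulVec_add, dotProduct_add, add_dotProduct]
  rw [hX.dotProduct_mulVec_comm (intVec l) v, dotProduct_comm (intVec l) β]
  ring

theorem isThetaLike_thetaChar (hX : X ∈ siegelUpperHalfSpace g) (a : Fin g → ℝ) (β : Fin g → ℂ) :
    IsThetaLike (realVec a) β X fun z => thetaChar (realVec a) β z X where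
  continuous := continuous_thetaChar hX a β
  differentiable_line := differentiable_thetaChar_line hX a β
  add_int z n := thetaChar_add_int _ _ z n
  add_mulVec z l := thetaChar_add_mulVec hX.1 _ _ z l

/-- Theta-functions with given multipliers are unique up to a factor. -/
theorem IsThetaLike.exists_eq_mul (hX : X ∈ siegelUpperHalfSpace g) {a : Fin g → ℝ}
    {β : Fin g → ℂ} {f : (Fin g → ℂ) → ℂ} (hf : IsThetaLike (realVec a) β X f) :
    ∃ κ : ℂ, ∀ z, f z = κ * thetaChar (realVec a) β z X := by
  set α := realVec a
  set F : (Fin g → ℂ) → ℂ := fun z =>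
    Complex.exp (-(2 * Real.pi * Complex.I * dotProduct α z)) * f z with hFdef
  have hc : Continuous F := by
    refine Continuous.mul ?_ hf.continuous
    unfold dotProduct
    fun_prop
  have hd : ∀ w u, Differentiable ℂ fun τ : ℂ => F (w + τ • u) := by
    intro w u
    refine Differentiable.mul ?_ (hf.differentiable_line w u)
    simp only [dotProduct_add, dotProduct_smul, smul_eq_mul]
    fun_prop
  have hF : ∀ z (n : Fin g → ℤ), F (z + intVec n) = F z := by
    intro z n
    simp only [hFdef]
    rw [hf.add_int, ← mul_assoc, ← Complex.exp_add, dotProduct_add]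
    congr 2
    ring
  set c : (Fin g → ℤ) → ℂ := fun n => UnitAddTorus.mFourierCoeff (torusFun F 0) n with hcdef
  have hFX : ∀ z (l : Fin g → ℤ), F (z + X.mulVec (intVec l)) =
      Complex.exp (-(2 * Real.pi * Complex.I * (dotProduct α (X.mulVec (intVec l))
        + dotProduct β (intVec l)))
      - Real.pi * Complex.I * dotProduct (intVec l) (X.mulVec (intVec l))) *
      (Complex.exp (- (2 * Real.pi * Complex.I * dotProduct (intVec l) z)) * F z) := by
    intro z l
    simp only [hFdef]
    rw [hf.add_mulVec, ← mul_assoc, ← mul_assoc, ← mul_assoc, ← Complex.exp_add, ← Complex.exp_add,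
      ← Complex.exp_add, dotProduct_add]
    congr 2
    ring
  -- The coefficient of index 0 of the translate by `X l` is computed twice. Translation leaves it
  -- equal to `c 0`; the multiplier contains the character of index `-l` and so turns it into a
  -- multiple of `c l`.
  have hcoef : ∀ l, c l = Complex.exp (2 * Real.pi * Complex.I * (dotProduct α (X.mulVec (intVec l))
        + dotProduct β (intVec l))
      + Real.pi * Complex.I * dotProduct (intVec l) (X.mulVec (intVec l))) * c 0 := by
    intro l
    have h1 := mFourierCoeff_torusFun hF hc hd 0 (X.mulVec (intVec l))
    simp only [intVec_zero, zero_dotProduct, mul_zero, Complex.exp_zero, one_mul] at h1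
    have h2 : UnitAddTorus.mFourierCoeff (torusFun F (X.mulVec (intVec l))) 0 =
        Complex.exp (-(2 * Real.pi * Complex.I * (dotProduct α (X.mulVec (intVec l))
          + dotProduct β (intVec l)))
        - Real.pi * Complex.I * dotProduct (intVec l) (X.mulVec (intVec l))) * c l := by
      simp only [hcdef]
      unfold UnitAddTorus.mFourierCoeff
      rw [← MeasureTheory.integral_const_mul]
      refine MeasureTheory.integral_congr_ae (Filter.Eventually.of_forall fun ξ => ?_)
      simp only [smul_eq_mul, neg_zero, UnitAddTorus.mFourier_zero, ContinuousMap.one_apply, one_mul]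
      rw [torusFun, hFX]
      congr 1
      have h3 := mFourier_torusMk (-l) (torusRep ξ)
      rw [torusMk_torusRep, intVec_neg, neg_dotProduct, mul_neg] at h3
      rw [h3, torusFun, add_zero]
    rw [← show UnitAddTorus.mFourierCoeff (torusFun F (X.mulVec (intVec l))) 0 = c 0 from h1, h2,
      ← mul_assoc, ← Complex.exp_add]
    rw [show ∀ x y : ℂ, x + y + (-x - y) = 0 by intros; ring, Complex.exp_zero, one_mul]
  -- This is `c 0` divided by the term of index 0 of the theta-series at `z = 0`.
  set κ := c 0 * Complex.exp (-(Real.pi * Complex.I * dotProduct α (X.mulVec α)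
    + 2 * Real.pi * Complex.I * dotProduct α β)) with hκ
  have hterm : ∀ z n, c n * Complex.exp (2 * Real.pi * Complex.I * dotProduct (intVec n) z) =
      Complex.exp (-(2 * Real.pi * Complex.I * dotProduct α z)) * κ * thetaTerm α (z + β) X n := by
    intro z n
    have h1 : Complex.exp (2 * Real.pi * Complex.I * (dotProduct α (X.mulVec (intVec n))
          + dotProduct β (intVec n))
        + Real.pi * Complex.I * dotProduct (intVec n) (X.mulVec (intVec n))) *
        Complex.exp (2 * Real.pi * Complex.I * dotProduct (intVec n) z) =
        Complex.exp (-(2 * Real.pi * Complex.I * dotProduct α z)) *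
        Complex.exp (-(Real.pi * Complex.I * dotProduct α (X.mulVec α)
          + 2 * Real.pi * Complex.I * dotProduct α β)) * thetaTerm α (z + β) X n := by
      rw [thetaTerm, ← Complex.exp_add, ← Complex.exp_add, ← Complex.exp_add]
      congr 1
      simp only [Matrix.mulVec_add, dotProduct_add, add_dotProduct]
      rw [hX.1.dotProduct_mulVec_comm (intVec n) α, dotProduct_comm (intVec n) β]
      ring
    rw [hcoef n, hκ]
    linear_combination c 0 * h1
  refine ⟨κ, fun z => ?_⟩
  have hsum : Summable fun n => c n * Complex.exp (2 * Real.pi * Complex.I * dotProduct (intVec n) z) := by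
    simp only [hterm]
    exact ((summable_norm_thetaTerm hX a (z + β)).of_norm).mul_left _
  have h1 := (hasSum_fourier_of_periodic hF hc hd z hsum).tsum_eq
  have h2 : F z = Complex.exp (-(2 * Real.pi * Complex.I * dotProduct α z)) *
      (κ * thetaChar α β z X) := by
    rw [← h1, thetaChar_eq_tsum, ← mul_assoc, ← tsum_mul_left]
    exact tsum_congr (hterm z)
  exact mul_left_cancel₀ (Complex.exp_ne_zero _) h2

/-- The theta-function is not identically zero. -/
theorem exists_thetaChar_ne_zero (hX : X ∈ siegelUpperHalfSpace g) (a : Fin g → ℝ)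
    (β : Fin g → ℂ) : ∃ z, thetaChar (realVec a) β z X ≠ 0 := by
  by_contra! h
  set α := realVec a
  -- On real arguments the theta-series is a character times an absolutely convergent Fourier
  -- series. Its coefficient of index 0 is an exponential, hence not zero.
  have hterm : ∀ (x : Fin g → ℝ) n, thetaTerm α (realVec x + β) X n =
      Complex.exp (2 * Real.pi * Complex.I * dotProduct α (realVec x)) * (thetaTerm α β X n *
        Complex.exp (2 * Real.pi * Complex.I * dotProduct (intVec n) (realVec x))) := by
    intro x n
    rw [thetaTerm, thetaTerm, ← Complex.exp_add, ← Complex.exp_add]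
    congr 1
    simp only [dotProduct_add, add_dotProduct]
    ring
  have h0 := fourier_coeff_zero_of_forall_tsum_eq_zero (summable_norm_thetaTerm hX a β) fun x => by
    have h1 := h (realVec x)
    rw [thetaChar_eq_tsum] at h1
    simp only [hterm] at h1
    rw [tsum_mul_left] at h1
    exact (mul_eq_zero.1 h1).resolve_left (Complex.exp_ne_zero _)
  exact Complex.exp_ne_zero _ h0

end

/-! ### The symplectic action on the Siegel upper half space -/

open Matrix
open scoped ComplexOrder

/-- For `v = x + iy` the cross terms cancel by symmetry, and the Hermitian form is `xᵗYx + yᵗYy`.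
Passing to complex matrices allows congruence by the complex matrix `CX + D`. -/
theorem Matrix.PosDef.map_ofReal {g : ℕ} {Y : Matrix (Fin g) (Fin g) ℝ} (hY : Y.PosDef) :
    (Y.map Complex.ofReal).PosDef := by
  refine Matrix.PosDef.of_dotProduct_mulVec_pos ?_ fun v hv => ?_
  · ext i j
    have := congrFun (congrFun hY.isHermitian i) j
    simp only [conjTranspose_apply, star_trivial] at this
    simp [this]
  · set x : Fin g → ℝ := fun i => (v i).re
    set y : Fin g → ℝ := fun i => (v i).im
    have hsymm : Y.IsSymm := by
      simpa [IsSymm, IsHermitian, conjTranspose_eq_transpose_of_trivial] using hY.isHermitian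
    have hv' : v = realVec x + Complex.I • realVec y := by
      ext i
      simp [x, y, mul_comm Complex.I, Complex.re_add_im]
    have hstar : star v = realVec x - Complex.I • realVec y := by
      rw [hv']
      ext i
      simp [sub_eq_add_neg]
    have hq : ∀ p q : Fin g → ℝ, dotProduct (realVec p) ((Y.map Complex.ofReal).mulVec (realVec q))
        = ((dotProduct p (Y.mulVec q) : ℝ) : ℂ) := by
      intro p q
      simp [dotProduct, mulVec]
    have key : dotProduct (star v) ((Y.map Complex.ofReal).mulVec v)
        = ((dotProduct x (Y.mulVec x) + dotProduct y (Y.mulVec y) : ℝ) : ℂ) := by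
      rw [hstar, hv']
      simp only [mulVec_add, mulVec_smul, dotProduct_add, sub_dotProduct, dotProduct_smul,
        smul_dotProduct, hq, smul_eq_mul]
      rw [hsymm.dotProduct_mulVec_comm y x]
      push_cast
      linear_combination (-(dotProduct y (Y.mulVec y) : ℝ) : ℂ) * Complex.I_mul_I
    rw [key]
    have h0 : ∀ x : Fin g → ℝ, 0 ≤ dotProduct x (Y.mulVec x) := fun x => by
      simpa using hY.posSemidef.dotProduct_mulVec_nonneg x
    have h1 : ∀ x : Fin g → ℝ, x ≠ 0 → 0 < dotProduct x (Y.mulVec x) := fun x hx => by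
      simpa using hY.dotProduct_mulVec_pos hx
    have : 0 < dotProduct x (Y.mulVec x) + dotProduct y (Y.mulVec y) := by
      by_cases hx : x = 0
      · have hy : y ≠ 0 := by
          rintro hy
          exact hv (by rw [hv', hx, hy]; simp)
        linarith [h0 x, h1 y hy]
      · linarith [h1 x hx, h0 y]
    exact_mod_cast this

theorem Matrix.PosDef.of_map_ofReal {g : ℕ} {Y : Matrix (Fin g) (Fin g) ℝ}
    (hY : (Y.map Complex.ofReal).PosDef) : Y.PosDef := by
  refine Matrix.PosDef.of_dotProduct_mulVec_pos ?_ fun x hx => ?_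
  · ext i j
    have := congrFun (congrFun hY.isHermitian i) j
    simp only [conjTranspose_apply, map_apply, RCLike.star_def, Complex.conj_ofReal,
      Complex.ofReal_inj] at this
    simp [this]
  · have h := hY.dotProduct_mulVec_pos (x := realVec x) (fun h => hx (by
      ext i
      simpa using congrFun h i))
    have hq : dotProduct (star (realVec x)) ((Y.map Complex.ofReal).mulVec (realVec x))
        = ((dotProduct x (Y.mulVec x) : ℝ) : ℂ) := by
      simp [dotProduct, mulVec]
    rw [hq] at h
    simpa using h

/-- The block relations of a symplectic matrix. -/
structure SymplecticRelations {g : ℕ} {R : Type*} [CommRing R]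
    (A B C D : Matrix (Fin g) (Fin g) R) : Prop where
  AB : A * Bᵀ = B * Aᵀ
  CD : C * Dᵀ = D * Cᵀ
  AD : A * Dᵀ - B * Cᵀ = 1
  AC : Aᵀ * C = Cᵀ * A
  BD : Bᵀ * D = Dᵀ * B
  ADt : Aᵀ * D - Cᵀ * B = 1

theorem symplecticRelations_of_mem {g : ℕ} {R : Type*} [CommRing R]
    {A B C D : Matrix (Fin g) (Fin g) R} (h : fromBlocks A B C D ∈ symplecticGroup (Fin g) R) :
    SymplecticRelations A B C D := by
  have h1 := SymplecticGroup.mem_iff.1 h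
  have h2 := SymplecticGroup.mem_iff'.1 h
  simp only [J, fromBlocks_transpose, fromBlocks_multiply, fromBlocks_inj, Matrix.mul_zero,
    Matrix.mul_one, Matrix.mul_neg, zero_add, add_zero, Matrix.neg_mul] at h1 h2
  obtain ⟨a1, a2, a3, a4⟩ := h1
  obtain ⟨b1, b2, b3, b4⟩ := h2
  refine ⟨?_, ?_, ?_, ?_, ?_, ?_⟩
  · exact (add_neg_eq_zero.1 a1).symm
  · exact (add_neg_eq_zero.1 a4).symm
  · rw [← neg_inj, ← a2]; abel
  · exact (add_neg_eq_zero.1 b1).symm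
  · exact (add_neg_eq_zero.1 b4).symm
  · rw [← neg_inj, ← b2]; abel

theorem SymplecticRelations.map {g : ℕ} {R S : Type*} [CommRing R] [CommRing S]
    {A B C D : Matrix (Fin g) (Fin g) R} (h : SymplecticRelations A B C D) (f : R →+* S) :
    SymplecticRelations (A.map f) (B.map f) (C.map f) (D.map f) := by
  have key : ∀ {U V : Matrix (Fin g) (Fin g) R}, U = V → U.map f = V.map f := fun h => by rw [h]
  have hs : ∀ U V : Matrix (Fin g) (Fin g) R, (U - V).map f = U.map f - V.map f := fun U V => by
    ext; simp
  constructor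
  · simpa only [Matrix.map_mul, transpose_map] using key h.AB
  · simpa only [Matrix.map_mul, transpose_map] using key h.CD
  · simpa [Matrix.map_mul, transpose_map, hs] using key h.AD
  · simpa only [Matrix.map_mul, transpose_map] using key h.AC
  · simpa only [Matrix.map_mul, transpose_map] using key h.BD
  · simpa [Matrix.map_mul, transpose_map, hs] using key h.ADt

section

variable {g : ℕ} {A B C D X : Matrix (Fin g) (Fin g) ℂ}

theorem SymplecticRelations.transpose_mul_comm (h : SymplecticRelations A B C D) (hX : X.IsSymm) :
    (A * X + B)ᵀ * (C * X + D) = (C * X + D)ᵀ * (A * X + B) := by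
  have e1 := h.AC
  have e2 := h.BD
  have e3 := h.ADt
  have e4 : Dᵀ * A - Bᵀ * C = 1 := by
    have := congrArg transpose e3
    simpa using this
  simp only [transpose_add, transpose_mul, hX.eq, Matrix.add_mul, Matrix.mul_add]
  have r1 : X * Aᵀ * (C * X) = X * Cᵀ * (A * X) := by
    simp only [Matrix.mul_assoc]; rw [← Matrix.mul_assoc Aᵀ, e1, Matrix.mul_assoc]
  have r2 : X * Aᵀ * D = X * Cᵀ * B + X := by
    rw [Matrix.mul_assoc, sub_eq_iff_eq_add.1 e3, Matrix.mul_add, Matrix.mul_assoc]; simp [add_comm]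
  have r3 : Dᵀ * (A * X) = Bᵀ * (C * X) + X := by
    rw [← Matrix.mul_assoc, sub_eq_iff_eq_add.1 e4, Matrix.add_mul, Matrix.mul_assoc]
    simp [add_comm]
  rw [r1, r2, r3, e2]
  abel

/-- For real blocks conjugation affects only `X`, so the symplectic relations cancel everything
except `X - Xᴴ`. Both the invertibility of `CX + D` and the positivity of the new imaginary part
rest on this identity. -/
theorem SymplecticRelations.conjTranspose_mul_sub (h : SymplecticRelations A B C D)
    (hA : Aᴴ = Aᵀ) (hB : Bᴴ = Bᵀ) (hC : Cᴴ = Cᵀ) (hD : Dᴴ = Dᵀ) :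
    (C * X + D)ᴴ * (A * X + B) - (A * X + B)ᴴ * (C * X + D) = X - Xᴴ := by
  have e1 := h.AC
  have e2 := h.BD
  have e3 := h.ADt
  have e4 : Dᵀ * A - Bᵀ * C = 1 := by
    have := congrArg transpose e3
    simpa using this
  simp only [conjTranspose_add, conjTranspose_mul, hA, hB, hC, hD, Matrix.add_mul, Matrix.mul_add]
  have r1 : Xᴴ * Aᵀ * (C * X) = Xᴴ * Cᵀ * (A * X) := by
    simp only [Matrix.mul_assoc]; rw [← Matrix.mul_assoc Aᵀ, e1, Matrix.mul_assoc]
  have r2 : Xᴴ * Aᵀ * D = Xᴴ * Cᵀ * B + Xᴴ := by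
    rw [Matrix.mul_assoc, sub_eq_iff_eq_add.1 e3, Matrix.mul_add, Matrix.mul_assoc]; simp [add_comm]
  have r3 : Dᵀ * (A * X) = Bᵀ * (C * X) + X := by
    rw [← Matrix.mul_assoc, sub_eq_iff_eq_add.1 e4, Matrix.add_mul, Matrix.mul_assoc]
    simp [add_comm]
  rw [r1, r2, r3, e2]
  abel

theorem sub_conjTranspose_of_isSymm (hX : X.IsSymm) :
    X - Xᴴ = (2 * Complex.I) • (X.map Complex.im).map Complex.ofReal := by
  ext i j
  have h : X j i = X i j := hX.apply i j
  simp [conjTranspose_apply, h, Complex.sub_conj]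
  ring

/-- A kernel vector `v` of `CX + D` would give `vᴴ (X - Xᴴ) v = 0`, contrary to the positivity of
`Im X`. -/
theorem SymplecticRelations.isUnit_det (h : SymplecticRelations A B C D)
    (hX : X ∈ siegelUpperHalfSpace g)
    (hA : Aᴴ = Aᵀ) (hB : Bᴴ = Bᵀ) (hC : Cᴴ = Cᵀ) (hD : Dᴴ = Dᵀ) : IsUnit (C * X + D).det := by
  have h1 := h.conjTranspose_mul_sub (X := X) hA hB hC hD
  rw [sub_conjTranspose_of_isSymm hX.1] at h1
  rw [isUnit_iff_ne_zero]
  intro h0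
  obtain ⟨v, hv, hv0⟩ := exists_mulVec_eq_zero_iff.2 h0
  have h2 := congrArg (fun N => dotProduct (star v) (N.mulVec v)) h1
  simp only [sub_mulVec, ← mulVec_mulVec, hv0, mulVec_zero, sub_zero, smul_mulVec,
    dotProduct_smul] at h2
  have h3 := hX.2.map_ofReal.dotProduct_mulVec_pos hv
  rw [dotProduct_mulVec, ← star_mulVec, hv0, star_zero, zero_dotProduct, smul_eq_mul] at h2
  have : (2 * Complex.I : ℂ) ≠ 0 := by simp
  exact h3.ne' ((mul_eq_zero.1 h2.symm).resolve_left this)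

/-- With `M = CX + D`, cancelling `M` in `transpose_mul_comm` gives symmetry of `Y`, and
`conjTranspose_mul_sub` becomes `Mᴴ (Im Y) M = Im X`. Congruence by an invertible matrix preserves
positivity. -/
theorem SymplecticRelations.smul_mem (h : SymplecticRelations A B C D)
    (hX : X ∈ siegelUpperHalfSpace g)
    (hA : Aᴴ = Aᵀ) (hB : Bᴴ = Bᵀ) (hC : Cᴴ = Cᵀ) (hD : Dᴴ = Dᵀ) :
    (A * X + B) * (C * X + D)⁻¹ ∈ siegelUpperHalfSpace g := by
  have hu := h.isUnit_det hX hA hB hC hD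
  have h1 := h.conjTranspose_mul_sub (X := X) hA hB hC hD
  have h2 := h.transpose_mul_comm hX.1
  set P := A * X + B
  set M := C * X + D
  set Y := P * M⁻¹ with hYdef
  have hP : P = Y * M := by rw [hYdef, Matrix.mul_assoc, nonsing_inv_mul _ hu, Matrix.mul_one]
  have hut : IsUnit Mᵀ.det := by rwa [det_transpose]
  have huM : IsUnit M := (isUnit_iff_isUnit_det M).2 hu
  have hsymm : Y.IsSymm := by
    rw [hP, transpose_mul, Matrix.mul_assoc, ← Matrix.mul_assoc] at h2
    have h3 : Mᵀ * Yᵀ = Mᵀ * Y := by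
      have := congrArg (· * M⁻¹) h2
      simpa [Matrix.mul_assoc, mul_nonsing_inv _ hu] using this
    have := congrArg (Mᵀ⁻¹ * ·) h3
    simp only [← Matrix.mul_assoc, nonsing_inv_mul _ hut, Matrix.one_mul] at this
    exact this
  refine ⟨hsymm, Matrix.PosDef.of_map_ofReal ?_⟩
  rw [hP, conjTranspose_mul, sub_conjTranspose_of_isSymm hX.1] at h1
  have h4 : Mᴴ * (Y * M) - Mᴴ * Yᴴ * M = Mᴴ * (Y - Yᴴ) * M := by
    simp only [Matrix.mul_sub, Matrix.sub_mul, Matrix.mul_assoc]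
  rw [h4, sub_conjTranspose_of_isSymm hsymm, Matrix.mul_smul, Matrix.smul_mul] at h1
  have h5 := smul_right_injective _ (show (2 * Complex.I : ℂ) ≠ 0 by simp) h1
  have h6 := huM.posDef_star_left_conjugate_iff (x := (Y.map Complex.im).map Complex.ofReal)
  rw [star_eq_conjTranspose] at h6
  rw [← h6, h5]
  exact hX.2.map_ofReal

end

/-! ### Periods of the new basis of cycles -/

/-- Period matrices of a combined system of cycles. -/
theorem halfPeriodMatrix_combineCycles {g : ℕ} (M K : Matrix (Fin g) (Fin g) ℤ)
    (b a : Fin g → Fin g → ℂ) :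
    halfPeriodMatrix (combineCycles M K b a) =
      halfPeriodMatrix b * (M.map (Int.cast : ℤ → ℂ))ᵀ
        + halfPeriodMatrix a * (K.map (Int.cast : ℤ → ℂ))ᵀ := by
  ext i j
  simp only [halfPeriodMatrix, combineCycles, of_apply, Matrix.add_apply, Matrix.mul_apply,
    transpose_apply, map_apply, Finset.sum_apply, Pi.add_apply, Finset.sum_div,
    ← Finset.sum_add_distrib]
  refine Finset.sum_congr rfl fun k _ => ?_
  rw [Pi.smul_apply, Pi.smul_apply, zsmul_eq_mul, zsmul_eq_mul]
  ring

theorem halfPeriodMatrix_combineCycles_eq {g : ℕ} {a b : Fin g → Fin g → ℂ}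
    (ha : IsUnit (halfPeriodMatrix a).det) (M K : Matrix (Fin g) (Fin g) ℤ)
    (hab : (riemannMatrix a b).IsSymm) :
    halfPeriodMatrix (combineCycles M K b a) = halfPeriodMatrix a *
      (M.map (Int.cast : ℤ → ℂ) * riemannMatrix a b + K.map (Int.cast : ℤ → ℂ))ᵀ := by
  rw [halfPeriodMatrix_combineCycles, transpose_add, transpose_mul, hab.eq, Matrix.mul_add,
    riemannMatrix, ← Matrix.mul_assoc, ← Matrix.mul_assoc, mul_nonsing_inv _ ha, Matrix.one_mul]

/-! ### Multipliers of the transformed theta-function -/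

section

variable {g : ℕ} {A B C D X : Matrix (Fin g) (Fin g) ℂ}

theorem SymplecticRelations.mul_transpose_comm (h : SymplecticRelations A B C D) (hX : X.IsSymm) :
    C * (C * X + D)ᵀ = (C * X + D) * Cᵀ := by
  rw [transpose_add, transpose_mul, hX.eq, Matrix.mul_add, Matrix.add_mul, h.CD,
    Matrix.mul_assoc]

/-- This is the matrix of the quadratic exponent in the transformation law; its symmetry merges the
cross terms between `z` and a period. -/
theorem SymplecticRelations.isSymm_inv_mul (h : SymplecticRelations A B C D) (hX : X.IsSymm)
    (hu : IsUnit (C * X + D).det) : ((C * X + D)⁻¹ * C).IsSymm := by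
  have h1 := h.mul_transpose_comm hX
  set M := C * X + D
  have hut : IsUnit Mᵀ.det := by rwa [det_transpose]
  have h2 : (M⁻¹ * C)ᵀ = M⁻¹ * (M * Cᵀ) * Mᵀ⁻¹ := by
    rw [← Matrix.mul_assoc, nonsing_inv_mul _ hu, Matrix.one_mul, transpose_mul,
      transpose_nonsing_inv]
  rw [IsSymm, h2, ← h1, Matrix.mul_assoc, Matrix.mul_assoc, mul_nonsing_inv _ hut, Matrix.mul_one]

/-- The action of a symplectic matrix on periods. -/
theorem SymplecticRelations.transpose_inv_mulVec (h : SymplecticRelations A B C D) (hX : X.IsSymm)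
    (hu : IsUnit (C * X + D).det) (l n : Fin g → ℂ) :
    (C * X + D)⁻¹ᵀ.mulVec (X.mulVec l + n) =
      ((A * X + B) * (C * X + D)⁻¹).mulVec (D.mulVec l - C.mulVec n)
        + (A.mulVec n - B.mulVec l) := by
  have h1 := h.transpose_mul_comm hX
  have e1 := h.AB
  have e2 := h.CD
  have e3 := h.AD
  have e4 : D * Aᵀ - C * Bᵀ = 1 := by simpa using congrArg transpose e3
  set M := C * X + D with hM
  set P := A * X + B with hP
  have hut : IsUnit Mᵀ.det := by rwa [det_transpose]
  have hsymm : P * M⁻¹ = M⁻¹ᵀ * Pᵀ := by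
    rw [transpose_nonsing_inv, ← Matrix.one_mul (P * M⁻¹), ← nonsing_inv_mul _ hut,
      Matrix.mul_assoc, ← Matrix.mul_assoc Mᵀ, ← h1, Matrix.mul_assoc, mul_nonsing_inv _ hu,
      Matrix.mul_one]
  have hinv : M⁻¹ᵀ * Mᵀ = 1 := by rw [← transpose_mul, mul_nonsing_inv _ hu, transpose_one]
  have r1 : Pᵀ * D - Mᵀ * B = X := by
    rw [hP, hM, transpose_add, transpose_add, transpose_mul, transpose_mul, hX.eq, Matrix.add_mul,
      Matrix.add_mul, h.BD, Matrix.mul_assoc, Matrix.mul_assoc, sub_eq_iff_eq_add.1 h.ADt,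
      Matrix.mul_add, Matrix.mul_one]
    abel
  have e5 : Dᵀ * A - Bᵀ * C = 1 := by simpa using congrArg transpose h.ADt
  have r2 : Mᵀ * A - Pᵀ * C = 1 := by
    rw [hP, hM, transpose_add, transpose_add, transpose_mul, transpose_mul, hX.eq, Matrix.add_mul,
      Matrix.add_mul, Matrix.mul_assoc, Matrix.mul_assoc, h.AC, sub_eq_iff_eq_add.1 e5]
    abel
  have l1 : X = Pᵀ * D - Mᵀ * B := r1.symm
  -- The period is rewritten in its new integer coordinates. Multiplication by `M⁻ᵗ` then cancels
  -- `Mᵗ` and turns `Pᵗ` into `P M⁻¹`.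
  have key : X.mulVec l + n = Pᵀ.mulVec (D.mulVec l - C.mulVec n)
      + Mᵀ.mulVec (A.mulVec n - B.mulVec l) := by
    conv_lhs => rw [← Matrix.one_mulVec n, ← r2, l1]
    simp only [sub_mulVec, mulVec_sub, mulVec_mulVec]
    abel
  rw [key, mulVec_add, mulVec_mulVec, mulVec_mulVec, ← hsymm, hinv, one_mulVec]

/-- The multiplier of a transformed theta-function. -/
theorem SymplecticRelations.transformed_theta_add (h : SymplecticRelations A B C D)
    (hX : X.IsSymm) (hu : IsUnit (C * X + D).det)
    (hY : ((A * X + B) * (C * X + D)⁻¹).IsSymm) (α β z : Fin g → ℂ) {l n m' n' : Fin g → ℤ}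
    (hm : intVec m' = D.mulVec (intVec l) - C.mulVec (intVec n))
    (hn : intVec n' = A.mulVec (intVec n) - B.mulVec (intVec l)) :
    Complex.exp (-(Real.pi * Complex.I * dotProduct (z + (X.mulVec (intVec l) + intVec n))
        (((C * X + D)⁻¹ * C).mulVec (z + (X.mulVec (intVec l) + intVec n))))) *
      thetaChar α β ((C * X + D)⁻¹ᵀ.mulVec (z + (X.mulVec (intVec l) + intVec n)))
        ((A * X + B) * (C * X + D)⁻¹) =
    Complex.exp (2 * Real.pi * Complex.I * (dotProduct α (intVec n') - dotProduct β (intVec m'))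
      + Real.pi * Complex.I * (dotProduct (intVec m') (intVec n') -
        dotProduct (intVec l) (intVec n))
      - Real.pi * Complex.I * dotProduct (intVec l) (X.mulVec (intVec l))
      - 2 * Real.pi * Complex.I * dotProduct (intVec l) z) *
    (Complex.exp (-(Real.pi * Complex.I * dotProduct z (((C * X + D)⁻¹ * C).mulVec z))) *
      thetaChar α β ((C * X + D)⁻¹ᵀ.mulVec z) ((A * X + B) * (C * X + D)⁻¹)) := by
  have hp := h.transpose_inv_mulVec hX hu (intVec l) (intVec n)
  have hQ := h.isSymm_inv_mul hX hu
  set p := X.mulVec (intVec l) + intVec n with hpdef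
  have hQp : ((C * X + D)⁻¹ * C).mulVec p + (C * X + D)⁻¹.mulVec (intVec m') = intVec l := by
    have h1 : C.mulVec p + intVec m' = (C * X + D).mulVec (intVec l) := by
      rw [hm, hpdef, mulVec_add, mulVec_mulVec, add_mulVec]
      abel
    rw [← mulVec_mulVec, ← mulVec_add, h1, mulVec_mulVec, nonsing_inv_mul _ hu, one_mulVec]
  rw [← hm, ← hn] at hp
  set M := C * X + D
  set Y := (A * X + B) * M⁻¹
  set Q := M⁻¹ * C
  have hW : ∀ u v : Fin g → ℂ, dotProduct u (M⁻¹ᵀ.mulVec v) = dotProduct v (M⁻¹.mulVec u) := by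
    intro u v
    rw [mulVec_transpose, dotProduct_comm, ← dotProduct_mulVec]
  -- The identities `s1` and `s2` compare the parts of the exponents that are linear in `z` and
  -- independent of `z`. The quadratic factor supplies what changes the multiplier for `Y` into the
  -- one for `X`.
  have s1 : dotProduct z (Q.mulVec p) + dotProduct (intVec m') (M⁻¹ᵀ.mulVec z)
      = dotProduct (intVec l) z := by
    rw [hW, ← dotProduct_add, hQp, dotProduct_comm]
  have s2 : dotProduct p (Q.mulVec p) + dotProduct (intVec m') (Y.mulVec (intVec m'))
      = dotProduct (intVec l) (X.mulVec (intVec l)) + dotProduct (intVec l) (intVec n)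
        - dotProduct (intVec m') (intVec n') := by
    have t1 : Y.mulVec (intVec m') = M⁻¹ᵀ.mulVec p - intVec n' := by rw [hp]; abel
    have t2 : Q.mulVec p = intVec l - M⁻¹.mulVec (intVec m') := by rw [← hQp]; abel
    rw [t1, t2, dotProduct_sub, dotProduct_sub, hW, hpdef, add_dotProduct, add_dotProduct,
      dotProduct_comm (X.mulVec (intVec l)) (intVec l), dotProduct_comm (intVec n) (intVec l)]
    ring
  clear_value p
  rw [mulVec_add M⁻¹ᵀ, hp, ← add_assoc (M⁻¹ᵀ.mulVec z), thetaChar_add_int, thetaChar_add_mulVec hY, ← mul_assoc,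
    ← mul_assoc, ← mul_assoc, ← Complex.exp_add, ← Complex.exp_add, ← Complex.exp_add]
  congr 2
  rw [mulVec_add, dotProduct_add, add_dotProduct, add_dotProduct, hQ.dotProduct_mulVec_comm p z]
  linear_combination (-(2 * Real.pi * Complex.I)) * s1 - Real.pi * Complex.I * s2

end

/-! ### Characteristics modulo 2 -/

/-- A bit vector as an integer vector. -/
def bitVec {g : ℕ} (p : Fin g → Fin 2) : Fin g → ℤ := fun i => ((p i : ℕ) : ℤ)

/-- A bit vector as a vector over the field with two elements. -/
def bitZMod {g : ℕ} (p : Fin g → Fin 2) : Fin g → ZMod 2 := p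

theorem bitZMod_injective {g : ℕ} : Function.Injective (bitZMod (g := g)) := fun _ _ h => h

theorem intCast_bitVec {g : ℕ} (p : Fin g → Fin 2) (i : Fin g) :
    ((bitVec p i : ℤ) : ZMod 2) = bitZMod p i := by
  have : ∀ x : Fin 2, (((x : ℕ) : ℤ) : ZMod 2) = (x : ZMod 2) := by
    intro x
    fin_cases x <;> rfl
  exact this (p i)

theorem halfVec_eq_realVec {g : ℕ} (p : Fin g → Fin 2) :
    halfVec p = realVec fun i => (p i : ℕ) / 2 := by
  ext i
  simp [halfVec]

theorem two_mul_halfVec_dotProduct {g : ℕ} (p : Fin g → Fin 2) (n : Fin g → ℤ) :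
    2 * dotProduct (halfVec p) (intVec n) = ((dotProduct (bitVec p) n : ℤ) : ℂ) := by
  simp only [dotProduct, halfVec, bitVec, intVec_apply, Finset.mul_sum]
  push_cast
  exact Finset.sum_congr rfl fun i _ => by ring

theorem exp_pi_I_mul_intCast_congr {a b : ℤ} (h : (a : ZMod 2) = b) :
    Complex.exp (Real.pi * Complex.I * a) = Complex.exp (Real.pi * Complex.I * b) := by
  obtain ⟨k, hk⟩ := (ZMod.intCast_eq_intCast_iff_dvd_sub a b 2).1 h
  rw [Complex.exp_eq_exp_iff_exists_int]
  refine ⟨-k, ?_⟩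
  have : (b : ℂ) = a + 2 * k := by
    have h1 : b = a + 2 * k := by push_cast at hk; omega
    rw [h1]
    push_cast
    ring
  rw [this]
  push_cast
  ring

/-- A symmetric quadratic form over the field with two elements is the linear form given by the
diagonal. -/
theorem Matrix.IsSymm.dotProduct_mulVec_self_zmod_two {g : ℕ} {S : Matrix (Fin g) (Fin g) (ZMod 2)}
    (hS : S.IsSymm) (n : Fin g → ZMod 2) :
    dotProduct n (S.mulVec n) = dotProduct (fun i => S i i) n := by
  have h1 : dotProduct n (S.mulVec n)
      = ∑ p ∈ (Finset.univ : Finset (Fin g × Fin g)), n p.1 * (S p.1 p.2 * n p.2) := by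
    simp only [dotProduct, mulVec, Finset.mul_sum, Fintype.sum_prod_type]
  rw [h1, ← Finset.univ_product_univ, ← Finset.diag_union_offDiag,
    Finset.sum_union (Finset.disjoint_diag_offDiag _), Finset.sum_diag]
  rw [show ∑ p ∈ (Finset.univ : Finset (Fin g)).offDiag, n p.1 * (S p.1 p.2 * n p.2) = 0 from ?_,
    add_zero, dotProduct]
  · refine Finset.sum_congr rfl fun i _ => ?_
    have : ∀ x y : ZMod 2, x * (y * x) = y * x := by decide
    exact this _ _
  -- Off the diagonal the terms at `(i, j)` and `(j, i)` agree by symmetry and cancel in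
  -- characteristic 2.
  · refine Finset.sum_involution (fun p _ => p.swap) (fun p _ => ?_) (fun p hp _ h => ?_)
      (fun p hp => ?_) (fun p _ => Prod.swap_swap p)
    · have : S p.2 p.1 = S p.1 p.2 := hS.apply _ _
      simp only [Prod.fst_swap, Prod.snd_swap, this]
      have : ∀ x y z : ZMod 2, x * (y * z) + z * (y * x) = 0 := by decide
      exact this _ _ _
    · exact (Finset.mem_offDiag.1 hp).2.2 (congrArg Prod.snd h)
    · simp only [Finset.mem_offDiag, Finset.mem_univ, true_and, Prod.fst_swap, Prod.snd_swap] at hp ⊢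
      exact hp.symm

/-- The affine action of a symplectic matrix on half-integer characteristics. -/
def charMap {g : ℕ} (A B C D : Matrix (Fin g) (Fin g) (ZMod 2)) (c : HalfChar g) : HalfChar g :=
  (Aᵀ.mulVec (bitZMod c.1) + Cᵀ.mulVec (bitZMod c.2) + fun i => (Cᵀ * A) i i,
    Bᵀ.mulVec (bitZMod c.1) + Dᵀ.mulVec (bitZMod c.2) + fun i => (Dᵀ * B) i i)

theorem bitZMod_charMap_fst {g : ℕ} (A B C D : Matrix (Fin g) (Fin g) (ZMod 2)) (c : HalfChar g) :
    bitZMod (charMap A B C D c).1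
      = Aᵀ.mulVec (bitZMod c.1) + Cᵀ.mulVec (bitZMod c.2) + fun i => (Cᵀ * A) i i := rfl

theorem bitZMod_charMap_snd {g : ℕ} (A B C D : Matrix (Fin g) (Fin g) (ZMod 2)) (c : HalfChar g) :
    bitZMod (charMap A B C D c).2
      = Bᵀ.mulVec (bitZMod c.1) + Dᵀ.mulVec (bitZMod c.2) + fun i => (Dᵀ * B) i i := rfl

/-- The translation part drops out, and the symplectic relations give a left inverse of the linear
part. On a finite set this already makes `charMap` a permutation. -/
theorem charMap_injective {g : ℕ} {A B C D : Matrix (Fin g) (Fin g) (ZMod 2)}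
    (h : SymplecticRelations A B C D) : Function.Injective (charMap A B C D) := by
  intro c d hcd
  have h1 := congrArg (fun x : HalfChar g => bitZMod x.1) hcd
  have h2 := congrArg (fun x : HalfChar g => bitZMod x.2) hcd
  simp only [bitZMod_charMap_fst, bitZMod_charMap_snd, add_left_inj] at h1 h2
  have e4 : D * Aᵀ - C * Bᵀ = 1 := by simpa using congrArg transpose h.AD
  have k1 : ∀ x y : Fin g → ZMod 2, D.mulVec (Aᵀ.mulVec x + Cᵀ.mulVec y)
      - C.mulVec (Bᵀ.mulVec x + Dᵀ.mulVec y) = x := by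
    intro x y
    simp only [mulVec_add, mulVec_mulVec]
    rw [h.CD, sub_eq_iff_eq_add.1 e4, add_mulVec, one_mulVec]
    abel
  have k2 : ∀ x y : Fin g → ZMod 2, A.mulVec (Bᵀ.mulVec x + Dᵀ.mulVec y)
      - B.mulVec (Aᵀ.mulVec x + Cᵀ.mulVec y) = y := by
    intro x y
    simp only [mulVec_add, mulVec_mulVec]
    rw [h.AB, sub_eq_iff_eq_add.1 h.AD, add_mulVec, one_mulVec]
    abel
  refine Prod.ext (bitZMod_injective ?_) (bitZMod_injective ?_)
  · rw [← k1 (bitZMod c.1) (bitZMod c.2), h1, h2, k1]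
  · rw [← k2 (bitZMod c.1) (bitZMod c.2), h1, h2, k2]

/-- A matrix of integers as a matrix of residues modulo `2`. -/
abbrev modTwo {g : ℕ} (A : Matrix (Fin g) (Fin g) ℤ) : Matrix (Fin g) (Fin g) (ZMod 2) :=
  A.map (Int.castRingHom (ZMod 2))

/-- A matrix of integers as a complex matrix. -/
abbrev toComplexMatrix {g : ℕ} (A : Matrix (Fin g) (Fin g) ℤ) : Matrix (Fin g) (Fin g) ℂ :=
  A.map (Int.castRingHom ℂ)

theorem conjTranspose_toComplexMatrix {g : ℕ} (A : Matrix (Fin g) (Fin g) ℤ) :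
    (toComplexMatrix A)ᴴ = (toComplexMatrix A)ᵀ := by
  ext i j
  simp [conjTranspose_apply]

theorem intVec_mulVec {g : ℕ} (A : Matrix (Fin g) (Fin g) ℤ) (n : Fin g → ℤ) :
    intVec (A.mulVec n) = (toComplexMatrix A).mulVec (intVec n) := by
  ext i
  simp [mulVec, dotProduct]

theorem intVec_sub {g : ℕ} (m n : Fin g → ℤ) : intVec (m - n) = intVec m - intVec n := by
  ext; simp

/-- Reduction of an integer vector modulo `2`. -/
def zmodVec {g : ℕ} (n : Fin g → ℤ) : Fin g → ZMod 2 := fun i => n i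

theorem zmodVec_mulVec {g : ℕ} (A : Matrix (Fin g) (Fin g) ℤ) (n : Fin g → ℤ) :
    zmodVec (A.mulVec n) = (modTwo A).mulVec (zmodVec n) := by
  ext i
  simp [mulVec, dotProduct, zmodVec]

theorem intCast_dotProduct_zmod {g : ℕ} (m n : Fin g → ℤ) :
    ((dotProduct m n : ℤ) : ZMod 2) = dotProduct (zmodVec m) (zmodVec n) := by
  simp [dotProduct, zmodVec]

theorem zmodVec_bitVec {g : ℕ} (p : Fin g → Fin 2) : zmodVec (bitVec p) = bitZMod p :=
  funext fun i => intCast_bitVec p i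

/-! ### The transformation law of theta-functions -/

section

variable {g : ℕ} {A B C D : Matrix (Fin g) (Fin g) ℤ} {X : Matrix (Fin g) (Fin g) ℂ}

theorem SymplecticRelations.toComplexMatrix (h : SymplecticRelations A B C D) :
    SymplecticRelations (toComplexMatrix A) (toComplexMatrix B) (toComplexMatrix C)
      (toComplexMatrix D) :=
  h.map _

/-- The multiplier of an integer period is `exp(πi k)` with `k` the integer on the left, so only its
parity matters. Modulo 2 the quadratic term in `n` is linear with coefficients the diagonal of
`CᵗA`; this is the origin of the translation in `charMap`. -/
theorem charMap_fst_parity (h : SymplecticRelations A B C D) (c : HalfChar g) (n : Fin g → ℤ) :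
    ((dotProduct (bitVec c.1) (A.mulVec n) + dotProduct (bitVec c.2) (C.mulVec n)
      - dotProduct (C.mulVec n) (A.mulVec n) : ℤ) : ZMod 2) =
    ((dotProduct (bitVec (charMap (modTwo A) (modTwo B) (modTwo C) (modTwo D) c).1) n : ℤ) :
      ZMod 2) := by
  have h2 := h.map (Int.castRingHom (ZMod 2))
  have hS : ((modTwo C)ᵀ * modTwo A).IsSymm := by
    rw [IsSymm, transpose_mul, transpose_transpose, h2.AC]
  push_cast
  simp only [intCast_dotProduct_zmod, zmodVec_bitVec, zmodVec_mulVec, bitZMod_charMap_fst,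
    add_dotProduct]
  rw [← hS.dotProduct_mulVec_self_zmod_two, CharTwo.sub_eq_add, ← mulVec_mulVec]
  simp only [dotProduct_mulVec, ← mulVec_transpose, transpose_transpose]

theorem charMap_snd_parity (h : SymplecticRelations A B C D) (c : HalfChar g) (l : Fin g → ℤ) :
    ((-dotProduct (bitVec c.1) (B.mulVec l) - dotProduct (bitVec c.2) (D.mulVec l)
      - dotProduct (D.mulVec l) (B.mulVec l) : ℤ) : ZMod 2) =
    ((-dotProduct (bitVec (charMap (modTwo A) (modTwo B) (modTwo C) (modTwo D) c).2) l : ℤ) :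
      ZMod 2) := by
  have h2 := h.map (Int.castRingHom (ZMod 2))
  have hS : ((modTwo D)ᵀ * modTwo B).IsSymm := by
    rw [IsSymm, transpose_mul, transpose_transpose, h2.BD]
  push_cast
  simp only [intCast_dotProduct_zmod, zmodVec_bitVec, zmodVec_mulVec, bitZMod_charMap_snd,
    add_dotProduct, CharTwo.neg_eq]
  rw [← hS.dotProduct_mulVec_self_zmod_two, CharTwo.sub_eq_add, CharTwo.sub_eq_add, ← mulVec_mulVec]
  simp only [dotProduct_mulVec, ← mulVec_transpose, transpose_transpose]

/-- The transformation law of theta-functions, with a factor independent of `z`. -/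
theorem exists_theta_transformation (h : SymplecticRelations A B C D)
    (hX : X ∈ siegelUpperHalfSpace g) (c : HalfChar g) {M Y : Matrix (Fin g) (Fin g) ℂ}
    (hM : M = toComplexMatrix C * X + toComplexMatrix D)
    (hY : Y = (toComplexMatrix A * X + toComplexMatrix B) * M⁻¹) :
    ∃ κ : ℂ, κ ≠ 0 ∧ ∀ z,
      Complex.exp (-(Real.pi * Complex.I * dotProduct z ((M⁻¹ * toComplexMatrix C).mulVec z))) *
        thetaChar (halfVec c.1) (halfVec c.2) (M⁻¹ᵀ.mulVec z) Y =
      κ * thetaChar (halfVec (charMap (modTwo A) (modTwo B) (modTwo C) (modTwo D) c).1)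
        (halfVec (charMap (modTwo A) (modTwo B) (modTwo C) (modTwo D) c).2) z X := by
  have hc := h.toComplexMatrix
  have hu := hc.isUnit_det hX (conjTranspose_toComplexMatrix A) (conjTranspose_toComplexMatrix B)
    (conjTranspose_toComplexMatrix C) (conjTranspose_toComplexMatrix D)
  have hYm := hc.smul_mem hX (conjTranspose_toComplexMatrix A) (conjTranspose_toComplexMatrix B)
    (conjTranspose_toComplexMatrix C) (conjTranspose_toComplexMatrix D)
  have hadd := fun z l n => hc.transformed_theta_add hX.1 hu hYm.1 (halfVec c.1) (halfVec c.2) z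
    (l := l) (n := n) (m' := D.mulVec l - C.mulVec n) (n' := A.mulVec n - B.mulVec l)
    (by rw [intVec_sub, intVec_mulVec, intVec_mulVec])
    (by rw [intVec_sub, intVec_mulVec, intVec_mulVec])
  rw [← hM] at hadd hYm hu
  rw [← hY] at hadd hYm
  set d := charMap (modTwo A) (modTwo B) (modTwo C) (modTwo D) c with hd
  have hlike : IsThetaLike (halfVec d.1) (halfVec d.2) X fun z =>
      Complex.exp (-(Real.pi * Complex.I * dotProduct z ((M⁻¹ * toComplexMatrix C).mulVec z))) *
        thetaChar (halfVec c.1) (halfVec c.2) (M⁻¹ᵀ.mulVec z) Y := by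
    have hth := isThetaLike_thetaChar hYm (fun i => ((c.1 i : ℕ) : ℝ) / 2) (halfVec c.2)
    rw [← halfVec_eq_realVec] at hth
    refine ⟨?_, ?_, ?_, ?_⟩
    · refine Continuous.mul ?_ (hth.continuous.comp ?_)
      · unfold dotProduct
        fun_prop
      · fun_prop
    · intro w u
      refine Differentiable.mul ?_ ?_
      · simp only [mulVec_add, mulVec_smul, dotProduct_add, add_dotProduct, dotProduct_smul,
          smul_dotProduct, smul_eq_mul]
        fun_prop
      · simp only [mulVec_add, mulVec_smul]
        exact hth.differentiable_line _ _
    · intro z n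
      -- Here `l = 0`, so the new coordinates of the period are `m' = -Cn` and `n' = An`.
      have h1 := hadd z 0 n
      simp only [intVec_zero, mulVec_zero, zero_add, zero_sub, sub_zero, zero_dotProduct, mul_zero,
        sub_zero] at h1
      rw [h1]
      congr 1
      have h2 := exp_pi_I_mul_intCast_congr (charMap_fst_parity h c n)
      rw [← hd, ← two_mul_halfVec_dotProduct] at h2
      rw [show (2 * Real.pi * Complex.I * dotProduct (halfVec d.1) (intVec n) : ℂ)
        = Real.pi * Complex.I * (2 * dotProduct (halfVec d.1) (intVec n)) by ring, ← h2]
      congr 1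
      push_cast
      rw [← two_mul_halfVec_dotProduct, ← two_mul_halfVec_dotProduct, ← dotProduct_intVec,
        intVec_neg, dotProduct_neg, neg_dotProduct]
      ring
    · intro z l
      have h1 := hadd z l 0
      simp only [intVec_zero, mulVec_zero, add_zero, zero_sub, sub_zero, dotProduct_zero] at h1
      rw [h1]
      congr 1
      have h2 := exp_pi_I_mul_intCast_congr (charMap_snd_parity h c l)
      rw [← hd, Int.cast_neg, ← two_mul_halfVec_dotProduct] at h2
      rw [sub_sub, sub_sub, Complex.exp_sub, Complex.exp_sub]
      rw [show (-(2 * Real.pi * Complex.I * dotProduct (halfVec d.2) (intVec l)) : ℂ)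
        = Real.pi * Complex.I * -(2 * dotProduct (halfVec d.2) (intVec l)) by ring, ← h2]
      congr 2
      push_cast
      rw [← two_mul_halfVec_dotProduct, ← two_mul_halfVec_dotProduct, ← dotProduct_intVec,
        intVec_neg, dotProduct_neg, dotProduct_neg]
      ring
  rw [halfVec_eq_realVec d.1] at hlike
  obtain ⟨κ, hκ⟩ := hlike.exists_eq_mul hX
  rw [← halfVec_eq_realVec d.1] at hκ
  refine ⟨κ, ?_, hκ⟩
  rintro rfl
  -- With `κ = 0`, the law at `Mᵗ z` would make the theta-function of `Y` vanish at every `z`.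
  obtain ⟨z, hz⟩ := exists_thetaChar_ne_zero hYm (fun i => ((c.1 i : ℕ) : ℝ) / 2) (halfVec c.2)
  rw [← halfVec_eq_realVec] at hz
  have h1 := hκ (Mᵀ.mulVec z)
  rw [mulVec_mulVec z M⁻¹ᵀ, ← transpose_mul, mul_nonsing_inv _ hu, transpose_one, one_mulVec,
    zero_mul] at h1
  exact hz ((mul_eq_zero.1 h1).resolve_left (Complex.exp_ne_zero _))

end

/-! ### Second moments, the heat equation and logarithmic derivatives -/

/-- The matrix of second moments of the theta-series, at the origin. -/
noncomputable def thetaHess {g : ℕ} (c : HalfChar g) (X : Matrix (Fin g) (Fin g) ℂ) :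
    Matrix (Fin g) (Fin g) ℂ :=
  of fun i j => ∑' m : Fin g → ℤ, (intVec m + halfVec c.1) i * (intVec m + halfVec c.1) j *
    thetaTerm (halfVec c.1) (halfVec c.2) X m

section

variable {g : ℕ} {X : Matrix (Fin g) (Fin g) ℂ}

theorem isSymm_thetaHess (c : HalfChar g) : (thetaHess c X).IsSymm := by
  ext i j
  simp only [thetaHess, transpose_apply, of_apply]
  exact tsum_congr fun m => by ring

/-- The real vector `p / 2`. -/
noncomputable def halfRealVec {g : ℕ} (p : Fin g → Fin 2) : Fin g → ℝ := fun i => (p i : ℕ) / 2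

theorem realVec_halfRealVec (p : Fin g → Fin 2) : realVec (halfRealVec p) = halfVec p :=
  (halfVec_eq_realVec p).symm

theorem thetaConst_eq_tsum (c : HalfChar g) (X : Matrix (Fin g) (Fin g) ℂ) :
    thetaConst c X = ∑' m, thetaTerm (halfVec c.1) (halfVec c.2) X m := by
  rw [thetaConst, thetaChar_eq_tsum, zero_add]

theorem norm_shift_apply_le (a : Fin g → ℝ) (m : Fin g → ℤ) (i : Fin g) :
    ‖(intVec m + realVec a) i‖ ≤ ‖shiftVec a m‖ := by
  rw [← realVec_shiftVec]
  simpa using norm_le_pi_norm (shiftVec a m) i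

theorem norm_shift_mul_le (a : Fin g → ℝ) (m : Fin g → ℤ) (i j : Fin g) :
    ‖(intVec m + realVec a) i * (intVec m + realVec a) j‖ ≤ ‖shiftVec a m‖ ^ 2 := by
  rw [norm_mul, sq]
  exact mul_le_mul (norm_shift_apply_le a m i) (norm_shift_apply_le a m j) (norm_nonneg _)
    (norm_nonneg _)

theorem sq_le_two_mul_exp {x : ℝ} (hx : 0 ≤ x) : x ^ 2 ≤ 2 * Real.exp (1 * x) := by
  have := Real.quadratic_le_exp_of_nonneg hx
  rw [one_mul]
  linarith

theorem summable_thetaHess (hX : X ∈ siegelUpperHalfSpace g) (c : HalfChar g) (i j : Fin g) :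
    Summable fun m : Fin g → ℤ => (intVec m + halfVec c.1) i * (intVec m + halfVec c.1) j *
      thetaTerm (halfVec c.1) (halfVec c.2) X m := by
  rw [← realVec_halfRealVec]
  refine Summable.of_norm ?_
  refine (summable_mul_norm_thetaTerm hX (halfRealVec c.1) (halfVec c.2) (P := fun m =>
    ‖(intVec m + realVec (halfRealVec c.1)) i * (intVec m + realVec (halfRealVec c.1)) j‖)
    (C := 2) (L := 1) fun m => ?_).congr fun m => (norm_mul _ _).symm
  rw [abs_norm]
  exact (norm_shift_mul_le _ m i j).trans (sq_le_two_mul_exp (norm_nonneg _))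

theorem dotProduct_symDir_mulVec (i j : Fin g) (v : Fin g → ℂ) :
    dotProduct v ((symDir i j).mulVec v) = v i * v j := by
  simp only [symDir, smul_mulVec, add_mulVec, dotProduct_smul, dotProduct_add, single_mulVec,
    smul_eq_mul, one_mul]
  simp only [Function.update_apply, dotProduct, Pi.zero_apply, mul_ite, mul_zero,
    Finset.sum_ite_eq', Finset.mem_univ, if_true]
  ring

/-- The heat equation: derivatives of theta-constants in the matrix of periods are second
moments. -/
theorem hasDerivAt_thetaConst (hX : X ∈ siegelUpperHalfSpace g) (c : HalfChar g) (i j : Fin g) :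
    HasDerivAt (fun t : ℂ => thetaConst c (X + t • symDir i j))
      (Real.pi * Complex.I * thetaHess c X i j) 0 := by
  obtain ⟨ε, hε, hle⟩ := exists_norm_thetaTerm_le hX
  set a := halfRealVec c.1 with ha
  -- Varying the period matrix changes the exponent quadratically in the index, so only a small disc
  -- is allowed: radius `ε / (2π)` uses up half of the decay rate `ε`.
  have hs : Summable fun m : Fin g → ℤ => ‖(1 : ℂ) * Complex.exp (Real.pi * Complex.I *
      dotProduct (intVec m + realVec a) (X.mulVec (intVec m + realVec a))
      + 2 * Real.pi * Complex.I * dotProduct (intVec m + realVec a) (halfVec c.2))‖ *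
      Real.exp (ε / (2 * Real.pi) * ‖Real.pi * Complex.I *
        ((intVec m + realVec a) i * (intVec m + realVec a) j)‖) := by
    refine (summable_exp_gaussian a (2 * Real.pi * g * ‖halfVec c.2‖) (half_pos hε)).of_nonneg_of_le
      (fun m => by positivity) fun m => ?_
    rw [one_mul]
    refine (mul_le_mul_of_nonneg_right (hle a (halfVec c.2) m) (Real.exp_pos _).le).trans ?_
    rw [← Real.exp_add, Real.exp_le_exp, norm_mul]
    have h2 : ‖(Real.pi * Complex.I : ℂ)‖ = Real.pi := by simp [abs_of_pos Real.pi_pos]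
    have h3 : ε / (2 * Real.pi) * (Real.pi * ‖(intVec m + realVec a) i *
        (intVec m + realVec a) j‖) = ε / 2 * ‖(intVec m + realVec a) i *
        (intVec m + realVec a) j‖ := by
      field_simp
    rw [h2, h3]
    have h4 := mul_le_mul_of_nonneg_left (norm_shift_mul_le a m i j) (half_pos hε).le
    linarith
  have key := hasDerivAt_tsum_exp hs (τ := 0) (by
    rw [norm_zero]
    positivity)
  have hterm : ∀ (t : ℂ) m, thetaTerm (realVec a) (halfVec c.2) (X + t • symDir i j) m =
      1 * Complex.exp (Real.pi * Complex.I *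
      dotProduct (intVec m + realVec a) (X.mulVec (intVec m + realVec a))
      + 2 * Real.pi * Complex.I * dotProduct (intVec m + realVec a) (halfVec c.2)
      + t * (Real.pi * Complex.I * ((intVec m + realVec a) i * (intVec m + realVec a) j))) := by
    intro t m
    rw [thetaTerm, one_mul, add_mulVec, smul_mulVec, dotProduct_add, dotProduct_smul,
      dotProduct_symDir_mulVec, smul_eq_mul]
    ring_nf
  have hfun : (fun t : ℂ => thetaConst c (X + t • symDir i j)) = fun t =>
      ∑' m, thetaTerm (realVec a) (halfVec c.2) (X + t • symDir i j) m := by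
    funext t
    rw [thetaConst_eq_tsum, ha, realVec_halfRealVec]
  rw [hfun]
  simp only [hterm]
  refine key.congr_deriv ?_
  rw [thetaHess, of_apply, ← tsum_mul_left]
  refine tsum_congr fun m => ?_
  rw [← realVec_halfRealVec c.1, thetaTerm, ← ha]
  ring_nf

/-- The first two derivatives of the theta-function at the origin along a line. -/
theorem exists_hasDerivAt_thetaChar_line (hX : X ∈ siegelUpperHalfSpace g) (c : HalfChar g)
    (u : Fin g → ℂ) : ∃ f : ℂ → ℂ,
      (∀ s, HasDerivAt (fun s : ℂ => thetaChar (halfVec c.1) (halfVec c.2) (s • u) X) (f s) s) ∧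
      HasDerivAt f ((2 * Real.pi * Complex.I) ^ 2 * dotProduct u ((thetaHess c X).mulVec u)) 0 := by
  set a := halfRealVec c.1 with ha
  have h1 := hasDerivAt_thetaSeries_line hX a (halfVec c.2) u (P := fun _ => 1) (C := 1) (L := 0)
    (by simp)
  -- The first derivative is again a weighted theta-series, with a weight linear in the index, so
  -- the same lemma differentiates it once more.
  have hP : ∀ m, ‖(1 : ℂ) * (2 * Real.pi * Complex.I * dotProduct (intVec m + realVec a) u)‖
      ≤ 2 * Real.pi * g * ‖u‖ * Real.exp (1 * ‖shiftVec a m‖) := by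
    intro m
    have h2 : ‖(2 * Real.pi * Complex.I : ℂ)‖ = 2 * Real.pi := by simp [abs_of_pos Real.pi_pos]
    rw [one_mul, norm_mul, ← realVec_shiftVec, h2, one_mul]
    have h3 := norm_dotProduct_le_card (shiftVec a m) u
    have h4 : ‖shiftVec a m‖ ≤ Real.exp ‖shiftVec a m‖ := by
      linarith [Real.add_one_le_exp ‖shiftVec a m‖]
    calc 2 * Real.pi * ‖dotProduct (realVec (shiftVec a m)) u‖
        ≤ 2 * Real.pi * (g * ‖shiftVec a m‖ * ‖u‖) := by gcongr
      _ = 2 * Real.pi * g * ‖u‖ * ‖shiftVec a m‖ := by ring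
      _ ≤ _ := by gcongr
  have h2 := hasDerivAt_thetaSeries_line hX a (halfVec c.2) u hP 0
  refine ⟨_, fun s => ?_, h2.congr_deriv ?_⟩
  · refine (h1 s).congr_of_eventuallyEq (Filter.Eventually.of_forall fun s => ?_)
    simp only [one_mul]
    rw [thetaChar_eq_tsum, add_comm, ha, realVec_halfRealVec]
  · have h3 : ∀ m, (1 : ℂ) * (2 * Real.pi * Complex.I * dotProduct (intVec m + realVec a) u) *
        (2 * Real.pi * Complex.I * dotProduct (intVec m + realVec a) u) *
        thetaTerm (realVec a) (halfVec c.2 + (0 : ℂ) • u) X m =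
        ∑ i, ∑ j, (2 * Real.pi * Complex.I) ^ 2 * (u i * u j) *
          ((intVec m + halfVec c.1) i * (intVec m + halfVec c.1) j *
            thetaTerm (halfVec c.1) (halfVec c.2) X m) := by
      intro m
      rw [zero_smul, add_zero, ha, realVec_halfRealVec]
      set v := intVec m + halfVec c.1
      have : dotProduct v u * dotProduct v u = ∑ i, ∑ j, u i * u j * (v i * v j) := by
        rw [dotProduct, Finset.sum_mul_sum]
        exact Finset.sum_congr rfl fun i _ => Finset.sum_congr rfl fun j _ => by ring
      calc _ = (2 * Real.pi * Complex.I) ^ 2 * (dotProduct v u * dotProduct v u) *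
            thetaTerm (halfVec c.1) (halfVec c.2) X m := by ring
        _ = _ := by
          rw [this]
          simp only [Finset.mul_sum, Finset.sum_mul]
          exact Finset.sum_congr rfl fun i _ => Finset.sum_congr rfl fun j _ => by ring
    rw [tsum_congr h3, Summable.tsum_finsetSum fun i _ => summable_sum fun j _ =>
      (summable_thetaHess hX c i j).mul_left _]
    simp only [dotProduct, mulVec, Finset.mul_sum]
    refine Finset.sum_congr rfl fun i _ => ?_
    rw [Summable.tsum_finsetSum fun j _ => (summable_thetaHess hX c i j).mul_left _]
    refine Finset.sum_congr rfl fun j _ => ?_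
    rw [tsum_mul_left, thetaHess, of_apply]
    ring

/-- The substitution `m ↦ -m - 2α` sends `m + α` to its negative and multiplies each term by
`(-1)^(4αᵗβ) = -1`. -/
theorem thetaConst_eq_zero_of_not_isEven (c : HalfChar g) (hc : ¬c.IsEven) : thetaConst c X = 0 := by
  have h1 : thetaConst c X = -thetaConst c X := by
    conv_lhs => rw [thetaConst_eq_tsum]
    rw [thetaConst_eq_tsum, ← tsum_neg,
      ← ((Equiv.neg (Fin g → ℤ)).trans (Equiv.subRight (bitVec c.1))).tsum_eq]
    refine tsum_congr fun m => ?_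
    have hv : intVec (((Equiv.neg (Fin g → ℤ)).trans (Equiv.subRight (bitVec c.1))) m)
        + halfVec c.1 = -(intVec m + halfVec c.1) := by
      ext i
      simp [bitVec, halfVec]
      ring
    have hodd : Odd (dotProduct (bitVec c.1) (bitVec c.2)) := by
      have := Nat.not_even_iff_odd.1 hc
      have h2 : dotProduct (bitVec c.1) (bitVec c.2)
          = ((∑ i, (c.1 i : ℕ) * (c.2 i : ℕ) : ℕ) : ℤ) := by
        simp [dotProduct, bitVec]
      rw [h2]
      exact_mod_cast this
    obtain ⟨k, hk⟩ := hodd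
    have h3 : 2 * dotProduct (intVec m + halfVec c.1) (halfVec c.2)
        = dotProduct m (bitVec c.2) + (2 * k + 1) / 2 := by
      have h4 := two_mul_halfVec_dotProduct c.2 m
      have h5 := two_mul_halfVec_dotProduct c.2 (bitVec c.1)
      have h6 : intVec (bitVec c.1) = 2 • halfVec c.1 := by
        ext i
        simp [bitVec, halfVec]
        ring
      rw [h6, dotProduct_smul, dotProduct_comm (bitVec c.2), hk] at h5
      rw [dotProduct_comm (bitVec c.2)] at h4
      rw [add_dotProduct, dotProduct_comm (intVec m), dotProduct_comm (halfVec c.1), mul_add, h4]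
      push_cast at h5
      simp only [nsmul_eq_mul, Nat.cast_ofNat] at h5
      linear_combination h5 / 2
    rw [thetaTerm, thetaTerm, hv, mulVec_neg, dotProduct_neg, neg_dotProduct, neg_neg,
      neg_dotProduct, ← neg_one_mul (Complex.exp _), ← Complex.exp_pi_mul_I, ← Complex.exp_add,
      Complex.exp_eq_exp_iff_exists_int]
    refine ⟨-(dotProduct m (bitVec c.2)) - k - 1, ?_⟩
    push_cast
    linear_combination (-(2 * Real.pi * Complex.I)) * h3
  exact self_eq_neg.1 h1

/-- Odd theta-constants vanish, so evenness is automatic. Hence preservation of parity by `charMap`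
need not be checked separately. -/
theorem mem_nonvanishingEven (c : HalfChar g) : c ∈ nonvanishingEven X ↔ thetaConst c X ≠ 0 := by
  classical
  rw [nonvanishingEven, Finset.mem_filter]
  refine ⟨fun h => h.2.2, fun h => ⟨Finset.mem_univ _, ?_, h⟩⟩
  by_contra hc
  exact h (thetaConst_eq_zero_of_not_isEven c hc)

theorem differentiableAt_thetaProdLine (hX : X ∈ siegelUpperHalfSpace g) (i j : Fin g) :
    DifferentiableAt ℂ (thetaProdLine X i j) 0 := by
  unfold thetaProdLine thetaProd
  exact DifferentiableAt.fun_finsetProd fun c _ => (hasDerivAt_thetaConst hX c i j).differentiableAt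

theorem logDeriv_thetaProdLine (hX : X ∈ siegelUpperHalfSpace g) (i j : Fin g) :
    logDeriv (thetaProdLine X i j) 0 = ∑ c ∈ nonvanishingEven X,
      Real.pi * Complex.I * thetaHess c X i j / thetaConst c X := by
  unfold thetaProdLine thetaProd
  rw [logDeriv_prod]
  · refine Finset.sum_congr rfl fun c _ => ?_
    rw [logDeriv_apply, (hasDerivAt_thetaConst hX c i j).deriv, zero_smul, add_zero]
  · intro c hc
    rw [zero_smul, add_zero]
    exact (mem_nonvanishingEven c).1 hc
  · exact fun c _ => (hasDerivAt_thetaConst hX c i j).differentiableAt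

theorem lambdaMatrix_eq (hX : X ∈ siegelUpperHalfSpace g) :
    lambdaMatrix X = -(Real.pi * Complex.I / ((nonvanishingEven X).card : ℂ)) •
      ∑ c ∈ nonvanishingEven X, (Real.pi * Complex.I / thetaConst c X) • thetaHess c X := by
  ext i j
  rw [lambdaMatrix, of_apply, logDeriv_thetaProdLine hX, Matrix.smul_apply, Matrix.sum_apply, smul_eq_mul]
  congr 1
  refine Finset.sum_congr rfl fun c _ => ?_
  rw [Matrix.smul_apply, smul_eq_mul]
  ring

theorem isSymm_lambdaMatrix (X : Matrix (Fin g) (Fin g) ℂ) : (lambdaMatrix X).IsSymm := by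
  ext i j
  simp only [lambdaMatrix, transpose_apply, of_apply]
  rw [show thetaProdLine X i j = thetaProdLine X j i by
    unfold thetaProdLine symDir; rw [add_comm]]

end

/-! ### The addition formula and a nonvanishing theta-constant -/

theorem two_smul_mem_siegelUpperHalfSpace {g : ℕ} {X : Matrix (Fin g) (Fin g) ℂ}
    (hX : X ∈ siegelUpperHalfSpace g) : (2 : ℂ) • X ∈ siegelUpperHalfSpace g := by
  refine ⟨hX.1.smul 2, ?_⟩
  have : ((2 : ℂ) • X).map Complex.im = (2 : ℝ) • X.map Complex.im := by
    ext i j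
    simp
  rw [this]
  exact hX.2.smul two_pos

/-- Pairs of integer vectors, parametrized by half the sum and half the difference. -/
def halfSumDiffEquiv (g : ℕ) :
    (Fin g → Fin 2) × (Fin g → ℤ) × (Fin g → ℤ) ≃ (Fin g → ℤ) × (Fin g → ℤ) where
  toFun p := (p.2.1 + p.2.2 + bitVec p.1, p.2.1 - p.2.2)
  invFun q := (fun i => ⟨((q.1 i + q.2 i) % 2).toNat, by omega⟩,
    fun i => (q.1 i + q.2 i) / 2, fun i => (q.1 i - q.2 i) / 2)
  left_inv p := by
    obtain ⟨d, k, l⟩ := p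
    have h : ∀ i, (d i : ℕ) < 2 := fun i => (d i).2
    refine Prod.ext (funext fun i => Fin.ext ?_) (Prod.ext (funext fun i => ?_) (funext fun i => ?_))
    all_goals
      have := h i
      simp only [bitVec, Pi.add_apply, Pi.sub_apply]
      omega
  right_inv q := by
    obtain ⟨m, n⟩ := q
    refine Prod.ext (funext fun i => ?_) (funext fun i => ?_)
    all_goals
      simp only [bitVec, Pi.add_apply, Pi.sub_apply]
      omega

section

variable {g : ℕ} {X : Matrix (Fin g) (Fin g) ℂ}

/-- The addition formula for theta-functions. -/
theorem thetaChar_mul_thetaChar (hX : X ∈ siegelUpperHalfSpace g) (x y : Fin g → ℂ) :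
    thetaChar 0 0 x X * thetaChar 0 0 y X = ∑ d : Fin g → Fin 2,
      thetaChar (halfVec d) 0 (x + y) ((2 : ℂ) • X) *
        thetaChar (halfVec d) 0 (x - y) ((2 : ℂ) • X) := by
  have hX2 := two_smul_mem_siegelUpperHalfSpace hX
  have hs : ∀ w, Summable fun m => ‖thetaTerm (0 : Fin g → ℂ) w X m‖ := fun w => by
    simpa using summable_norm_thetaTerm hX 0 w
  have hs2 : ∀ (d : Fin g → Fin 2) w, Summable fun m =>
      ‖thetaTerm (halfVec d) w ((2 : ℂ) • X) m‖ := fun d w => by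
    simpa only [realVec_halfRealVec] using summable_norm_thetaTerm hX2 (halfRealVec d) w
  have hterm : ∀ p : (Fin g → Fin 2) × (Fin g → ℤ) × (Fin g → ℤ),
      thetaTerm 0 x X (halfSumDiffEquiv g p).1 * thetaTerm 0 y X (halfSumDiffEquiv g p).2 =
      thetaTerm (halfVec p.1) (x + y) ((2 : ℂ) • X) p.2.1 *
        thetaTerm (halfVec p.1) (x - y) ((2 : ℂ) • X) p.2.2 := by
    rintro ⟨d, k, l⟩
    -- With `u = k + d/2` and `v = l + d/2` the two indices are `u + v` and `u - v`. The
    -- parallelogram law then separates the quadratic form into `2X` at `u` and at `v`.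
    have hm : intVec (halfSumDiffEquiv g (d, k, l)).1
        = (intVec k + halfVec d) + (intVec l + halfVec d) := by
      ext i
      simp [halfSumDiffEquiv, bitVec, halfVec]
      ring
    have hn : intVec (halfSumDiffEquiv g (d, k, l)).2
        = (intVec k + halfVec d) - (intVec l + halfVec d) := by
      ext i
      simp [halfSumDiffEquiv]
    simp only [thetaTerm, add_zero, hm, hn]
    rw [← Complex.exp_add, ← Complex.exp_add]
    congr 1
    generalize intVec k + halfVec d = u
    generalize intVec l + halfVec d = v
    simp only [smul_mulVec, mulVec_add, mulVec_sub, dotProduct_add, dotProduct_sub, add_dotProduct,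
      sub_dotProduct, dotProduct_smul, smul_eq_mul]
    ring
  have hprod : Summable fun q : (Fin g → ℤ) × (Fin g → ℤ) =>
      thetaTerm 0 x X q.1 * thetaTerm 0 y X q.2 :=
    summable_mul_of_summable_norm (hs x) (hs y)
  simp only [thetaChar_eq_tsum, add_zero]
  rw [tsum_mul_tsum_of_summable_norm (hs x) (hs y), ← (halfSumDiffEquiv g).tsum_eq,
    tsum_congr hterm, Summable.tsum_prod
      (((halfSumDiffEquiv g).summable_iff.2 hprod).congr hterm), tsum_fintype]
  refine Finset.sum_congr rfl fun d _ => ?_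
  exact (tsum_mul_tsum_of_summable_norm (hs2 d (x + y)) (hs2 d (x - y))).symm

/-- Orthogonality of the characters of the group of bit vectors. -/
theorem sum_exp_pi_I_bitVec (d e : Fin g → Fin 2) :
    ∑ q : Fin g → Fin 2, Complex.exp (Real.pi * Complex.I *
      ((dotProduct (bitVec d) (bitVec q) - dotProduct (bitVec e) (bitVec q) : ℤ) : ℂ))
      = if d = e then 2 ^ g else 0 := by
  have h1 : ∀ q : Fin g → Fin 2, Complex.exp (Real.pi * Complex.I *
      ((dotProduct (bitVec d) (bitVec q) - dotProduct (bitVec e) (bitVec q) : ℤ) : ℂ))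
      = ∏ i, Complex.exp (Real.pi * Complex.I * (((d i : ℕ) : ℂ) - (e i : ℕ)) * (q i : ℕ)) := by
    intro q
    rw [← Complex.exp_sum, ← sub_dotProduct]
    congr 1
    simp only [dotProduct, bitVec, Pi.sub_apply]
    push_cast
    rw [Finset.mul_sum]
    exact Finset.sum_congr rfl fun i _ => by ring
  simp only [h1]
  rw [← Fintype.piFinset_univ, ← Finset.prod_univ_sum (fun _ => Finset.univ) (fun i (r : Fin 2) =>
    Complex.exp (Real.pi * Complex.I * (((d i : ℕ) : ℂ) - (e i : ℕ)) * (r : ℕ)))]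
  simp only [Fin.sum_univ_two, Fin.val_zero, Fin.val_one, Nat.cast_zero, mul_zero, Complex.exp_zero,
    Nat.cast_one, mul_one]
  split_ifs with h
  · subst h
    simp [one_add_one_eq_two]
  · obtain ⟨i, hi⟩ := Function.ne_iff.1 h
    refine Finset.prod_eq_zero (Finset.mem_univ i) ?_
    generalize d i = r at hi
    generalize e i = s at hi
    fin_cases r <;> fin_cases s <;> simp_all [Complex.exp_neg]

/-- Some even theta-constant does not vanish. -/
theorem exists_thetaConst_ne_zero (hX : X ∈ siegelUpperHalfSpace g) :
    ∃ c : HalfChar g, thetaConst c X ≠ 0 := by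
  by_contra! h
  have hz : (halfVec 0 : Fin g → ℂ) = 0 := by
    ext; simp [halfVec]
  set T : (Fin g → Fin 2) → ℂ := fun d => thetaChar (halfVec d) 0 0 ((2 : ℂ) • X) with hT
  have h1 : ∀ q : Fin g → Fin 2, ∑ d, Complex.exp (Real.pi * Complex.I *
      ((dotProduct (bitVec d) (bitVec q) : ℤ) : ℂ)) * T d ^ 2 = 0 := by
    intro q
    have h2 := h (0, q)
    -- At `x = y = q/2` the left side is the square of the theta-constant of `[0, q/2]`, and the
    -- right side is a character sum in the squares `T d ^ 2`.
    have h3 := thetaChar_mul_thetaChar hX (halfVec q) (halfVec q)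
    rw [thetaConst, hz] at h2
    have h4 : thetaChar 0 0 (halfVec q) X = 0 := by
      rw [← h2, thetaChar_eq_tsum, thetaChar_eq_tsum, zero_add, add_zero]
    rw [h4, zero_mul] at h3
    rw [h3]
    refine Finset.sum_congr rfl fun d _ => ?_
    have h5 : halfVec q + halfVec q = 0 + intVec (bitVec q) := by
      ext i
      simp [halfVec, bitVec]
    rw [h5, sub_self, thetaChar_add_int, ← two_mul_halfVec_dotProduct, hT]
    ring_nf
  -- Inversion of the finite Fourier transform on bit vectors.
  have h6 : ∀ e, T e = 0 := by
    intro e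
    have h7 : ∑ q : Fin g → Fin 2, Complex.exp (-(Real.pi * Complex.I *
        ((dotProduct (bitVec e) (bitVec q) : ℤ) : ℂ))) * ∑ d, Complex.exp (Real.pi * Complex.I *
        ((dotProduct (bitVec d) (bitVec q) : ℤ) : ℂ)) * T d ^ 2 = 0 :=
      Finset.sum_eq_zero fun q _ => by rw [h1, mul_zero]
    simp only [Finset.mul_sum] at h7
    rw [Finset.sum_comm] at h7
    have h8 : ∀ d, ∑ q : Fin g → Fin 2, Complex.exp (-(Real.pi * Complex.I *
        ((dotProduct (bitVec e) (bitVec q) : ℤ) : ℂ))) * (Complex.exp (Real.pi * Complex.I *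
        ((dotProduct (bitVec d) (bitVec q) : ℤ) : ℂ)) * T d ^ 2)
        = (if d = e then 2 ^ g else 0) * T d ^ 2 := by
      intro d
      rw [← sum_exp_pi_I_bitVec, Finset.sum_mul]
      refine Finset.sum_congr rfl fun q _ => ?_
      rw [← mul_assoc, ← Complex.exp_add]
      congr 2
      push_cast
      ring
    simp only [h8, ite_mul, zero_mul, Finset.sum_ite_eq', Finset.mem_univ, if_true] at h7
    simpa using h7
  obtain ⟨z, hz0⟩ := exists_thetaChar_ne_zero hX 0 0
  rw [realVec_zero] at hz0
  -- At `x = y = z` every summand contains a factor `T d = 0`, which forces `θ(z)² = 0`.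
  have h9 := thetaChar_mul_thetaChar hX z z
  rw [Finset.sum_eq_zero fun d _ => by
    rw [sub_self, show thetaChar (halfVec d) 0 0 ((2 : ℂ) • X) = 0 from h6 d, mul_zero]] at h9
  exact hz0 (mul_self_eq_zero.1 h9)

theorem card_nonvanishingEven_pos (hX : X ∈ siegelUpperHalfSpace g) :
    0 < (nonvanishingEven X).card := by
  obtain ⟨c, hc⟩ := exists_thetaConst_ne_zero hX
  exact Finset.card_pos.2 ⟨c, (mem_nonvanishingEven c).2 hc⟩

end

/-! ### Transformation of the Hessians and of `Λ` -/

/-- A symmetric matrix is determined by its quadratic form. -/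
theorem Matrix.IsSymm.ext_dotProduct_mulVec {g : ℕ} {S T : Matrix (Fin g) (Fin g) ℂ}
    (hS : S.IsSymm) (hT : T.IsSymm)
    (h : ∀ u, dotProduct u (S.mulVec u) = dotProduct u (T.mulVec u)) : S = T := by
  ext i j
  have hpol : ∀ {R : Matrix (Fin g) (Fin g) ℂ}, R.IsSymm → ∀ u v,
      dotProduct (u + v) (R.mulVec (u + v)) =
        dotProduct u (R.mulVec u) + dotProduct v (R.mulVec v) + 2 * dotProduct u (R.mulVec v) := by
    intro R hR u v
    rw [mulVec_add, dotProduct_add, add_dotProduct, add_dotProduct, hR.dotProduct_mulVec_comm v u]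
    ring
  have h1 := h (Pi.single i 1 + Pi.single j 1)
  rw [hpol hS, hpol hT, h, h] at h1
  simpa using h1

section

variable {g : ℕ} {A B C D : Matrix (Fin g) (Fin g) ℤ} {X : Matrix (Fin g) (Fin g) ℂ}

/-- Both sides of the transformation law are compared at the origin, in value and in second
derivative along lines. The second derivative of the quadratic exponential, times the
theta-constant, produces the term in `C Mᵗ`. -/
theorem exists_thetaConst_thetaHess_transformation (h : SymplecticRelations A B C D)
    (hX : X ∈ siegelUpperHalfSpace g) (c : HalfChar g) {M Y : Matrix (Fin g) (Fin g) ℂ}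
    (hM : M = toComplexMatrix C * X + toComplexMatrix D)
    (hY : Y = (toComplexMatrix A * X + toComplexMatrix B) * M⁻¹) :
    ∃ κ : ℂ, κ ≠ 0 ∧
      thetaConst c Y = κ * thetaConst (charMap (modTwo A) (modTwo B) (modTwo C) (modTwo D) c) X ∧
      (Real.pi * Complex.I) • thetaHess c Y =
        (Real.pi * Complex.I * κ) •
          (M * thetaHess (charMap (modTwo A) (modTwo B) (modTwo C) (modTwo D) c) X * Mᵀ)
        + (thetaConst c Y / 2) • (toComplexMatrix C * Mᵀ) := by
  have hc := h.toComplexMatrix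
  have hu := hc.isUnit_det hX (conjTranspose_toComplexMatrix A) (conjTranspose_toComplexMatrix B)
    (conjTranspose_toComplexMatrix C) (conjTranspose_toComplexMatrix D)
  have hYm := hc.smul_mem hX (conjTranspose_toComplexMatrix A) (conjTranspose_toComplexMatrix B)
    (conjTranspose_toComplexMatrix C) (conjTranspose_toComplexMatrix D)
  have hcm := hc.mul_transpose_comm hX.1
  obtain ⟨κ, hκ0, hκ⟩ := exists_theta_transformation h hX c hM hY
  rw [← hM] at hYm hu hcm
  rw [← hY] at hYm
  set d := charMap (modTwo A) (modTwo B) (modTwo C) (modTwo D) c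
  have h0 : thetaConst c Y = κ * thetaConst d X := by
    have := hκ 0
    simpa [thetaConst] using this
  refine ⟨κ, hκ0, h0, ?_⟩
  have hsymmC : (toComplexMatrix C * Mᵀ).IsSymm := by
    rw [IsSymm, transpose_mul, transpose_transpose, hcm]
  refine Matrix.IsSymm.ext_dotProduct_mulVec ((isSymm_thetaHess c).smul _) (IsSymm.add ?_
    (hsymmC.smul _)) fun w => ?_
  · refine IsSymm.smul ?_ _
    rw [IsSymm, transpose_mul, transpose_mul, transpose_transpose, (isSymm_thetaHess d).eq,
      Matrix.mul_assoc]
  -- The line through `u` in the variable `z` corresponds to the line through `w` in the variable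
  -- `M⁻ᵗ z`.
  set u := Mᵀ.mulVec w with hudef
  have hw : M⁻¹ᵀ.mulVec u = w := by
    rw [hudef, mulVec_mulVec, ← transpose_mul, mul_nonsing_inv _ hu, transpose_one, one_mulVec]
  obtain ⟨f, hf1, hf2⟩ := exists_hasDerivAt_thetaChar_line hYm c w
  obtain ⟨k, hk1, hk2⟩ := exists_hasDerivAt_thetaChar_line hX d u
  set b := Real.pi * Complex.I * dotProduct u ((M⁻¹ * toComplexMatrix C).mulVec u) with hb
  have hfun : ∀ s : ℂ, Complex.exp (-(b * s ^ 2)) *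
      thetaChar (halfVec c.1) (halfVec c.2) (s • w) Y =
      κ * thetaChar (halfVec d.1) (halfVec d.2) (s • u) X := by
    intro s
    rw [← hκ (s • u), mulVec_smul, mulVec_smul, hw, dotProduct_smul, smul_dotProduct, hb,
      smul_eq_mul, smul_eq_mul]
    congr 3
    ring
  have hE : ∀ s : ℂ, HasDerivAt (fun s : ℂ => Complex.exp (-(b * s ^ 2)))
      (Complex.exp (-(b * s ^ 2)) * (-(b * (2 * s)))) s := by
    intro s
    refine HasDerivAt.cexp ?_
    refine HasDerivAt.fun_neg (HasDerivAt.const_mul b ?_)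
    simpa using hasDerivAt_pow 2 s
  have hd1 : ∀ s : ℂ, Complex.exp (-(b * s ^ 2)) * (-(b * (2 * s))) *
      thetaChar (halfVec c.1) (halfVec c.2) (s • w) Y + Complex.exp (-(b * s ^ 2)) * f s
      = κ * k s := by
    intro s
    have e1 := (hE s).mul (hf1 s)
    have e2 := (hk1 s).const_mul κ
    refine HasDerivAt.unique (e1.congr_of_eventuallyEq ?_) e2
    exact Filter.Eventually.of_forall fun s => (hfun s).symm
  have hlin : HasDerivAt (fun s : ℂ => -(b * (2 * s))) (-(b * (2 * 1))) 0 :=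
    (((hasDerivAt_id (0 : ℂ)).const_mul 2).const_mul b).neg
  have e1 := (((hE 0).mul hlin).mul (hf1 0)).add ((hE 0).mul hf2)
  have e2 := hk2.const_mul κ
  have hd2 := HasDerivAt.unique (e1.congr_of_eventuallyEq
    (Filter.Eventually.of_forall fun s => (hd1 s).symm)) e2
  have hth0 : thetaChar (halfVec c.1) (halfVec c.2) ((0 : ℂ) • w) Y = thetaConst c Y := by
    rw [zero_smul]; rfl
  simp only [hth0] at hd2
  norm_num at hd2
  have hq1 : dotProduct w ((M * thetaHess d X * Mᵀ).mulVec w)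
      = dotProduct u ((thetaHess d X).mulVec u) := by
    rw [← mulVec_mulVec, ← mulVec_mulVec, dotProduct_mulVec, ← mulVec_transpose]
  have hq2 : dotProduct w ((toComplexMatrix C * Mᵀ).mulVec w)
      = dotProduct u ((M⁻¹ * toComplexMatrix C).mulVec u) := by
    rw [← mulVec_mulVec, ← mulVec_mulVec, dotProduct_mulVec u, ← mulVec_transpose, hw]
  simp only [add_mulVec, smul_mulVec, dotProduct_add, dotProduct_smul, smul_eq_mul, hq1, hq2]
  have hpi : (Real.pi * Complex.I : ℂ) ≠ 0 := by simp [Real.pi_ne_zero]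
  -- The comparison `hd2` of second derivatives is the claim multiplied by `4πi`, as `(2πi)² = 4πi ·
  -- πi` and `2b = 4πi · (uᵗ M⁻¹C u) / 2`.
  refine mul_left_cancel₀ (mul_ne_zero (by norm_num : (4 : ℂ) ≠ 0) hpi) ?_
  rw [hb] at hd2
  linear_combination hd2

end

section

variable {g : ℕ} {A B C D : Matrix (Fin g) (Fin g) ℤ} {X : Matrix (Fin g) (Fin g) ℂ}

/-- The transformation law of the matrix `Λ`. -/
theorem lambdaMatrix_transformation (h : SymplecticRelations A B C D)
    (hX : X ∈ siegelUpperHalfSpace g) {M Y : Matrix (Fin g) (Fin g) ℂ}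
    (hM : M = toComplexMatrix C * X + toComplexMatrix D)
    (hY : Y = (toComplexMatrix A * X + toComplexMatrix B) * M⁻¹)
    (hYm : Y ∈ siegelUpperHalfSpace g) :
    lambdaMatrix Y = M * lambdaMatrix X * Mᵀ
      - (Real.pi * Complex.I / 2) • (toComplexMatrix C * Mᵀ) := by
  classical
  set T := charMap (modTwo A) (modTwo B) (modTwo C) (modTwo D) with hT
  have hinj : Function.Injective T := charMap_injective (h.map (Int.castRingHom (ZMod 2)))
  have hsurj : Function.Surjective T := Finite.surjective_of_injective hinj
  have hlaw := fun c => exists_thetaConst_thetaHess_transformation h hX c hM hY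
  have hmem : ∀ c, c ∈ nonvanishingEven Y ↔ T c ∈ nonvanishingEven X := by
    intro c
    obtain ⟨κ, hκ, h1, -⟩ := hlaw c
    rw [mem_nonvanishingEven, mem_nonvanishingEven, h1, ← hT, mul_ne_zero_iff]
    exact and_iff_right hκ
  have hcard : (nonvanishingEven Y).card = (nonvanishingEven X).card := by
    refine Finset.card_bij (fun c _ => T c) (fun c hc => (hmem c).1 hc) (fun c _ d _ hcd => hinj hcd)
      fun d hd => ?_
    obtain ⟨c, rfl⟩ := hsurj d
    exact ⟨c, (hmem c).2 hd, rfl⟩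
  -- Division by the theta-constant cancels the unknown `κ`, and the correction no longer depends on
  -- `c`.
  have hterm : ∀ c ∈ nonvanishingEven Y, (Real.pi * Complex.I / thetaConst c Y) • thetaHess c Y =
      M * ((Real.pi * Complex.I / thetaConst (T c) X) • thetaHess (T c) X) * Mᵀ
        + (1 / 2 : ℂ) • (toComplexMatrix C * Mᵀ) := by
    intro c hc
    have hc' := (mem_nonvanishingEven _).1 ((hmem c).1 hc)
    have hc0 := (mem_nonvanishingEven _).1 hc
    obtain ⟨κ, hκ, h1, h2⟩ := hlaw c
    rw [← hT] at h1 h2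
    have h3 : (Real.pi * Complex.I / thetaConst c Y) • thetaHess c Y
        = (thetaConst c Y)⁻¹ • ((Real.pi * Complex.I) • thetaHess c Y) := by
      rw [smul_smul]
      congr 1
      ring
    rw [h3, h2, smul_add, smul_smul, smul_smul, Matrix.mul_smul, Matrix.smul_mul]
    congr 2
    · rw [h1]
      field_simp
    · field_simp
  have hbij : ∀ F : HalfChar g → Matrix (Fin g) (Fin g) ℂ,
      ∑ c ∈ nonvanishingEven Y, F (T c) = ∑ c ∈ nonvanishingEven X, F c := by
    intro F
    refine Finset.sum_bij (fun c _ => T c) (fun c hc => (hmem c).1 hc)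
      (fun c _ d _ hcd => hinj hcd) (fun d hd => ?_) fun c _ => rfl
    obtain ⟨c, rfl⟩ := hsurj d
    exact ⟨c, (hmem c).2 hd, rfl⟩
  clear_value T
  have hsum : ∑ c ∈ nonvanishingEven Y, (Real.pi * Complex.I / thetaConst c Y) • thetaHess c Y =
      M * (∑ c ∈ nonvanishingEven X, (Real.pi * Complex.I / thetaConst c X) • thetaHess c X) * Mᵀ
        + ((nonvanishingEven X).card : ℂ) • ((1 / 2 : ℂ) • (toComplexMatrix C * Mᵀ)) := by
    rw [Finset.sum_congr rfl hterm, Finset.sum_add_distrib, Finset.sum_const, hcard,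
      Matrix.mul_sum, Matrix.sum_mul, Nat.cast_smul_eq_nsmul]
    rw [hbij fun d => M * ((Real.pi * Complex.I / thetaConst d X) • thetaHess d X) * Mᵀ]
  have hN : ((nonvanishingEven X).card : ℂ) ≠ 0 :=
    Nat.cast_ne_zero.2 (card_nonvanishingEven_pos hX).ne'
  -- The `N` equal corrections `C Mᵗ / 2` meet the prefactor `-πi / N`, leaving `-(πi / 2) C Mᵗ`.
  rw [lambdaMatrix_eq hYm, lambdaMatrix_eq hX, hsum, hcard, smul_add, smul_smul, smul_smul,
    Matrix.mul_smul, Matrix.smul_mul, sub_eq_add_neg, ← neg_smul]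
  congr 2
  field_simp

end

theorem mainTheorem2 (g : ℕ)
    -- period vectors of a canonical basis of cycles, satisfying the Riemann bilinear relations
    (a b : Fin g → Fin g → ℂ)
    (ha : IsUnit (halfPeriodMatrix a).det)
    (hab : riemannMatrix a b ∈ siegelUpperHalfSpace g)
    (A B C D : Matrix (Fin g) (Fin g) ℤ)
    (hγ : Matrix.fromBlocks A B C D ∈ Matrix.symplecticGroup (Fin g) ℤ)
    (𝔹 𝔹γ A' B' C' D' : Matrix (Fin g) (Fin g) ℂ)
    (h𝔹 : 𝔹 = riemannMatrix a b)
    -- the new basis of cycles is `bγ = A b + B a`, `aγ = C b + D a`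
    (h𝔹γ : 𝔹γ = riemannMatrix (combineCycles C D b a) (combineCycles A B b a))
    (hA' : A' = A.map (Int.cast : ℤ → ℂ)) (hB' : B' = B.map (Int.cast : ℤ → ℂ))
    (hC' : C' = C.map (Int.cast : ℤ → ℂ)) (hD' : D' = D.map (Int.cast : ℤ → ℂ)) :
    -- the new basis is admissible as well, and its Riemann matrix is the expected one
    IsUnit (halfPeriodMatrix (combineCycles C D b a)).det ∧
    𝔹γ ∈ siegelUpperHalfSpace g ∧
    IsUnit (C' * 𝔹 + D').det ∧
    𝔹γ = (A' * 𝔹 + B') * (C' * 𝔹 + D')⁻¹ ∧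
    -- `Λ` is well defined and symmetric
    0 < (nonvanishingEven 𝔹).card ∧
    (∀ i j, DifferentiableAt ℂ (thetaProdLine 𝔹 i j) 0) ∧
    (lambdaMatrix 𝔹).IsSymm ∧
    0 < (nonvanishingEven 𝔹γ).card ∧
    (∀ i j, DifferentiableAt ℂ (thetaProdLine 𝔹γ i j) 0) ∧
    (lambdaMatrix 𝔹γ).IsSymm ∧
    -- the transformation law
    lambdaMatrix 𝔹γ =
      (C' * 𝔹 + D') * lambdaMatrix 𝔹 * (C' * 𝔹 + D').transpose
        - (Real.pi * Complex.I / 2) • (C' * (C' * 𝔹 + D').transpose) := by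
  have hrel := symplecticRelations_of_mem hγ
  have hc := hrel.toComplexMatrix
  have hA : A' = toComplexMatrix A := hA'
  have hB : B' = toComplexMatrix B := hB'
  have hC : C' = toComplexMatrix C := hC'
  have hD : D' = toComplexMatrix D := hD'
  rw [← h𝔹] at hab
  have hu := hc.isUnit_det hab (conjTranspose_toComplexMatrix A) (conjTranspose_toComplexMatrix B)
    (conjTranspose_toComplexMatrix C) (conjTranspose_toComplexMatrix D)
  have hYm := hc.smul_mem hab (conjTranspose_toComplexMatrix A) (conjTranspose_toComplexMatrix B)
    (conjTranspose_toComplexMatrix C) (conjTranspose_toComplexMatrix D)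
  rw [← hC, ← hD] at hu
  rw [← hA, ← hB, ← hC, ← hD] at hYm
  have hω₁ : halfPeriodMatrix (combineCycles C D b a)
      = halfPeriodMatrix a * (C' * 𝔹 + D')ᵀ := by
    rw [halfPeriodMatrix_combineCycles_eq ha C D (h𝔹 ▸ hab.1), hC', hD', h𝔹]
  have hω₂ : halfPeriodMatrix (combineCycles A B b a)
      = halfPeriodMatrix a * (A' * 𝔹 + B')ᵀ := by
    rw [halfPeriodMatrix_combineCycles_eq ha A B (h𝔹 ▸ hab.1), hA', hB', h𝔹]
  have hω : IsUnit (halfPeriodMatrix (combineCycles C D b a)).det := by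
    rw [hω₁, det_mul, det_transpose]
    exact ha.mul hu
  -- The factor `ω₁` cancels and leaves the transpose of `(A𝔹 + B)(C𝔹 + D)⁻¹`, which is symmetric.
  have hY : 𝔹γ = (A' * 𝔹 + B') * (C' * 𝔹 + D')⁻¹ := by
    rw [← hYm.1.eq, h𝔹γ, riemannMatrix, hω₁, hω₂, Matrix.mul_inv_rev, Matrix.mul_assoc,
      ← Matrix.mul_assoc (halfPeriodMatrix a)⁻¹, nonsing_inv_mul _ ha, Matrix.one_mul,
      transpose_mul, transpose_nonsing_inv]
  rw [← hY] at hYm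
  refine ⟨hω, hYm, hu, hY, card_nonvanishingEven_pos hab, differentiableAt_thetaProdLine hab,
    isSymm_lambdaMatrix _, card_nonvanishingEven_pos hYm, differentiableAt_thetaProdLine hYm,
    isSymm_lambdaMatrix _, ?_⟩
  rw [hC]
  exact lambdaMatrix_transformation hrel hab (by rw [hD]) (by rw [hY, hA, hB, hC]) hYm
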